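/- Let $\mathcal H$ be a separable complex Hilbert space with a complex conjugation $\mathcal C$ (anti-unitary, $\mathcal C^2=\mathbf 1$); for bounded $T$ put $\overline T=\mathcal C T\mathcal C$ and $T^t=(\overline T)^*$. Let $I$ be a unitary operator with $\overline I=I$ and $I^2=-\mathbf 1$, and call $T$ odd symmetric if $I^*T^tI=T$. Let $\widehat{\mathbb{SF}}_*(\mathcal H)$ be the set of bounded self-adjoint Fredholm operators $F$ with $\|F\|=1$ and $\sigma_{\rm ess}(F)=\{-1,1\}$, with the norm topology. For a norm continuous path $s\in[\alpha,\beta]\mapsto F_s\in\widehat{\mathbb{SF}}_*(\mathcal H)$ the spectral flow is $$\mathrm{SF}(s\in[\alpha,\beta]\mapsto F_s)=\sum_{n=1}^N \mathrm{Tr}\big(\chi_{(a_n,0]}(F_{s_{n-1}})-\chi_{(a_n,0]}(F_{s_n})\big),$$ where $\alpha=s_0<s_1<\dots<s_N=\beta$ and $-1<a_n<0<b_n<1$ are such that $s\in[s_{n-1},s_n]\mapsto\chi_{(a_n,b_n]}(F_s)$ is norm continuous with constant finite rank for each $n$. Let $F\in\widehat{\mathbb{SF}}_*(\mathcal H)$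 be odd symmetric and let $U$ be an odd symmetric unitary on $\mathcal H$. Let $\Theta(F,U,I)$ be the set of norm continuous paths $s\in[0,1]\mapsto F_s\in\widehat{\mathbb{SF}}_*(\mathcal H)$ such that $F_0=F$, $F_s-F$ is compact for all $s\in[0,1]$, and $F_{1-s}=(IU)^*(F_s)^t(IU)$ for all $s\in[0,1]$. Then for every path in $\Theta(F,U,I)$ the spectral flow $\mathrm{SF}(s\in[0,\tfrac12]\mapsto F_s)\in\mathbb Z$ is well defined (admissible partitions exist and the value does not depend on their choice), and $$\mathrm{SF}(s\in[0,\tfrac12]\mapsto F_s)\bmod 2$$ is independent of the choice of the path $s\mapsto F_s$ in $\Theta(F,U,I)$, and thus defines $\mathrm{SF}_2(F,U)\in\mathbb Z_2$ whenever $\Theta(F,U,I)\neq\emptyset$. Moreover $\Theta(F,U,I)\neq\emptyset$ if and only if $[F,U]=FU-UF$ is compact, and in that case the path $s\in[0,1]\mapsto F+s\,U^*[F,U]$ belongs to $\Theta(F,U,I)$, so that $$\mathrm{SF}_2(F,U)=\mathrm{SF}\big(s\in[0,\tfrac12]\mapsto F+s\,U^*[F,U]\big)\bmod 2 .$$ 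-/

import Mathlib

open Set

namespace SpectralFlow

noncomputable section

variable {H : Type*} [NormedAddCommGroup H] [InnerProductSpace ℂ H] [CompleteSpace H]

/-! ### Real structure, transpose, odd symmetry -/

/-- The complex conjugate `C T C` of the bounded operator `T`, for a complex conjugation `C`. -/
def conjOp (C : H ≃ₗᵢ⋆[ℂ] H) (T : H →L[ℂ] H) : H →L[ℂ] H :=
  (C.toContinuousLinearEquiv : H →L⋆[ℂ] H).comp
    (T.comp (C.toContinuousLinearEquiv : H →L⋆[ℂ] H))

/-- The transpose `Tᵗ = (C T C)*`. -/
def transposeOp (C : H ≃ₗᵢ⋆[ℂ] H) (T : H →L[ℂ] H) : H →L[ℂ] H :=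
  star (conjOp C T)

/-- `T` is odd symmetric: `I* Tᵗ I = T`. -/
def IsOddSymmetric (C : H ≃ₗᵢ⋆[ℂ] H) (I T : H →L[ℂ] H) : Prop :=
  star I * transposeOp C T * I = T

/-! ### Self-adjoint Fredholm operators -/

/-- The essential spectrum: all `z` for which `T - z` is not Fredholm. -/
def essSpectrum (T : H →L[ℂ] H) : Set ℂ :=
  {z | ¬ (T - z • (1 : H →L[ℂ] H)).IsFredholm}

variable (H) in
/-- The self-adjoint Fredholm operators having both positive and negative essential spectrum. -/
def SFStar : Set (H →L[ℂ] H) :=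
  {F | IsSelfAdjoint F ∧ F.IsFredholm ∧
    (∃ x : ℝ, 0 < x ∧ (x : ℂ) ∈ essSpectrum F) ∧ ∃ x : ℝ, x < 0 ∧ (x : ℂ) ∈ essSpectrum F}

variable (H) in
/-- The retracted space: norm one and essential spectrum `{-1, 1}`. -/
def SFHat : Set (H →L[ℂ] H) :=
  {F | F ∈ SFStar H ∧ ‖F‖ = 1 ∧ essSpectrum F = {-1, 1}}

/-! ### Spectral projections and spectral flow -/

/-- The spectral projection `χ_{(-∞, c]}(F)` of a self-adjoint operator `F`: the orthogonal
projection onto the kernel of the positive part of `F - c` (the continuous function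
`x ↦ max (x - c) 0` vanishes exactly on `(-∞, c]`). -/
def specFamily (F : H →L[ℂ] H) (c : ℝ) : H →L[ℂ] H :=
  (cfc (fun x : ℝ => max (x - c) 0) F).ker.starProjection

/-- The spectral projection `χ_{(a, b]}(F)` of a self-adjoint operator `F`, for `a ≤ b`. -/
def specProj (F : H →L[ℂ] H) (a b : ℝ) : H →L[ℂ] H :=
  specFamily F b - specFamily F a

/-- The rank of `χ_{(a, b]}(F)`; when it is finite, this is the trace of that projection. -/
def specRank (F : H →L[ℂ] H) (a b : ℝ) : ℕ :=
  Module.finrank ℂ (specProj F a b).range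

/-- `m` is obtained as the spectral flow of the path `γ` on `[α, β]`: there are a partition
`α = s₀ < ⋯ < s_N = β` and numbers `-1 < aₙ < 0 < bₙ < 1` such that on each closed partition
interval `t ↦ χ_{(aₙ, bₙ]}(γ t)` is norm continuous with constant finite rank, and `m` is the sum of
the differences of `Tr χ_{(aₙ, 0]}(γ t)` between left and right end points. -/
def HasSpectralFlow (γ : ℝ → H →L[ℂ] H) (α β : ℝ) (m : ℤ) : Prop :=
  ∃ (N : ℕ) (s : Fin (N + 1) → ℝ) (a b : Fin N → ℝ),
    StrictMono s ∧ s 0 = α ∧ s (Fin.last N) = β ∧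
    (∀ n, -1 < a n ∧ a n < 0 ∧ 0 < b n ∧ b n < 1 ∧
      ContinuousOn (fun t => specProj (γ t) (a n) (b n)) (Icc (s n.castSucc) (s n.succ)) ∧
      ∃ r : ℕ, ∀ t ∈ Icc (s n.castSucc) (s n.succ),
        FiniteDimensional ℂ (specProj (γ t) (a n) (b n)).range ∧
        specRank (γ t) (a n) (b n) = r) ∧
    m = ∑ n, ((specRank (γ (s n.castSucc)) (a n) 0 : ℤ) - (specRank (γ (s n.succ)) (a n) 0 : ℤ))

open Classical in
/-- The spectral flow of `γ` on `[α, β]` (with the value `0` if there is none). -/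
def SF (γ : ℝ → H →L[ℂ] H) (α β : ℝ) : ℤ :=
  if h : ∃ m, HasSpectralFlow γ α β m then h.choose else 0

/-! ### Symmetric paths and the `ℤ₂`-valued spectral flow -/

/-- The set `Θ(F, U, I)` of norm continuous paths `γ` on `[0, 1]` in the retracted space with
`γ 0 = F`, with `γ s - F` compact, and with `γ (1 - s) = (I U)* (γ s)ᵗ (I U)`. Only the values on
`[0, 1]` matter. -/
def Theta (C : H ≃ₗᵢ⋆[ℂ] H) (I F U : H →L[ℂ] H) : Set (ℝ → H →L[ℂ] H) :=
  {γ | ContinuousOn γ (Icc 0 1) ∧ (∀ s ∈ Icc (0 : ℝ) 1, γ s ∈ SFHat H) ∧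
    γ 0 = F ∧ (∀ s ∈ Icc (0 : ℝ) 1, IsCompactOperator (γ s - F)) ∧
    ∀ s ∈ Icc (0 : ℝ) 1, γ (1 - s) = star (I * U) * transposeOp C (γ s) * (I * U)}

/-- The linear path `s ↦ F + s U* [F, U]`. -/
def linPath (F U : H →L[ℂ] H) : ℝ → H →L[ℂ] H :=
  fun s => F + (s : ℂ) • (star U * (F * U - U * F))

open Classical in
/-- The `ℤ₂`-valued spectral flow of `(F, U)`: the spectral flow modulo `2` on `[0, 1/2]` of some
path in `Θ(F, U, I)` (with the value `0` if there is no such path). -/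
def SF2 (C : H ≃ₗᵢ⋆[ℂ] H) (I F U : H →L[ℂ] H) : ZMod 2 :=
  if h : (Theta C I F U).Nonempty then ((SF h.choose 0 (1 / 2) : ℤ) : ZMod 2) else 0

end

end SpectralFlow

open Set

namespace SpectralFlow

noncomputable section

set_option linter.unusedSectionVars false

variable {H : Type*} [NormedAddCommGroup H] [InnerProductSpace ℂ H] [CompleteSpace H]
/-! ### Fredholm operators and compact perturbations -/

/-! The spectral flow is turned into the variation of a potential. By Weyl's theorem every
self-adjoint compact perturbation of `F` in the unit ball lies in `SFHat`, so all paths in `Theta`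
run inside one convex set K, `compactPerturbations F`. Near an operator of K whose spectrum avoids a
∈ (-1, 0), the integer rank of χ_{(a,0]} is a local primitive (up to sign) of the spectral flow: for
two such levels the ranks differ by the rank of a norm continuous projection, hence by a locally
constant function. On a convex set such local primitives glue (`exists_potential`) to a function φ,
and the spectral flow of a path in K is φ(end) - φ(start), whatever the partition
(`hasSpectralFlow_eq`).

Parity comes from Kramers degeneracy. With W = IU, the antiunitary J = CW satisfies J² = -1, by the
odd symmetry of U together with I² = -1. The symmetry of a path in `Theta` says that s ↦ 1 - s acts
as conjugation by J, so the midpoint commutes with J. For operators commuting with J the spectral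
subspaces are quaternionic, so their ranks are even (`even_specRank`), and φ mod 2 is locally
constant on the J-invariant part of K. That part is convex, hence φ mod 2 takes the same value at
the midpoints of all paths (`potential_emod_two_eq`), while all paths start at `F`.

Finally, conjugation by J exchanges F and U*FU. Thus every path ends at U*FU, which forces the
commutator to be compact; conversely the segment between the two operators is symmetric. -/

open scoped LinearMap.FiniteRangeSetoid in
theorem isFredholm_iff_exists_finiteRange {u : H →L[ℂ] H} :
    u.IsFredholm ↔ ∃ v : H →L[ℂ] H, FiniteDimensional ℂ (v * u - 1).range ∧
      FiniteDimensional ℂ (u * v - 1).range := by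
  have key : ∀ a b : H →L[ℂ] H, ((a : H →ₗ[ℂ] H) ∘ₗ (b : H →ₗ[ℂ] H) ≈ LinearMap.id) ↔
      FiniteDimensional ℂ (a * b - 1).range := fun a b => by
    rw [LinearMap.FiniteRangeSetoid.equiv_iff_hasNoetherianRange,
      LinearMap.HasNoetherianRange, IsNoetherian.iff_fg]
    rfl
  rw [ContinuousLinearMap.isFredholm_iff_exists_isQuasiInverse]
  refine exists_congr fun v => ?_
  rw [← key, ← key]
  rfl

theorem finiteDimensional_range_add {p q : H →L[ℂ] H} (hp : FiniteDimensional ℂ p.range)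
    (hq : FiniteDimensional ℂ q.range) : FiniteDimensional ℂ (p + q).range :=
  Submodule.finiteDimensional_of_le (LinearMap.range_add_le (p : H →ₗ[ℂ] H) (q : H →ₗ[ℂ] H))

theorem finiteDimensional_range_mul_right {p : H →L[ℂ] H} (hp : FiniteDimensional ℂ p.range)
    (q : H →L[ℂ] H) : FiniteDimensional ℂ (p * q).range :=
  Submodule.finiteDimensional_of_le (LinearMap.range_comp_le_range (q : H →ₗ[ℂ] H) (p : H →ₗ[ℂ] H))

theorem finiteDimensional_range_mul_left {p : H →L[ℂ] H} (hp : FiniteDimensional ℂ p.range)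
    (q : H →L[ℂ] H) : FiniteDimensional ℂ (q * p).range := by
  have : (q * p).range = p.range.map (q : H →ₗ[ℂ] H) :=
    LinearMap.range_comp (p : H →ₗ[ℂ] H) (q : H →ₗ[ℂ] H)
  rw [this]
  infer_instance

theorem isFredholm_of_isUnit {u : H →L[ℂ] H} (hu : IsUnit u) : u.IsFredholm := by
  obtain ⟨w, rfl⟩ := hu
  refine isFredholm_iff_exists_finiteRange.2 ⟨↑w⁻¹, ?_, ?_⟩
  · rw [Units.inv_mul, sub_self]
    change FiniteDimensional ℂ (0 : H →ₗ[ℂ] H).range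
    rw [LinearMap.range_zero]; infer_instance
  · rw [Units.mul_inv, sub_self]
    change FiniteDimensional ℂ (0 : H →ₗ[ℂ] H).range
    rw [LinearMap.range_zero]; infer_instance

/-- A compact operator on a Hilbert space is a norm limit of finite rank operators. -/
theorem exists_finiteRange_near {K : H →L[ℂ] H} (hK : IsCompactOperator K) {ε : ℝ} (hε : 0 < ε) :
    ∃ L : H →L[ℂ] H, FiniteDimensional ℂ L.range ∧ ‖K - L‖ ≤ ε := by
  have htb : TotallyBounded (K '' Metric.closedBall 0 1) :=
    (hK.isCompact_closure_image_closedBall 1).totallyBounded.subset subset_closure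
  obtain ⟨t, ht, hcov⟩ := Metric.totallyBounded_iff.1 htb ε hε
  let W : Submodule ℂ H := Submodule.span ℂ t
  have : FiniteDimensional ℂ W := FiniteDimensional.span_of_finite ℂ ht
  refine ⟨W.starProjection * K, ?_, ?_⟩
  · refine finiteDimensional_range_mul_right ?_ K
    rw [Submodule.range_starProjection]
    infer_instance
  · refine ContinuousLinearMap.opNorm_le_of_unit_norm hε.le fun x hx => ?_
    have hmem : K x ∈ K '' Metric.closedBall 0 1 := ⟨x, by simp [hx], rfl⟩
    obtain ⟨y, hy, hxy⟩ := mem_iUnion₂.1 (hcov hmem)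
    have h1 : ‖K x - W.starProjection (K x)‖ ≤ ‖K x - y‖ := by
      rw [Submodule.starProjection_minimal]
      exact ciInf_le ⟨0, by rintro _ ⟨w, rfl⟩; exact norm_nonneg _⟩
        (⟨y, Submodule.subset_span hy⟩ : W)
    have h2 : ‖K x - y‖ ≤ ε := by
      rw [← dist_eq_norm]; exact (Metric.mem_ball.1 hxy).le
    exact h1.trans h2

theorem isFredholm_add_finiteRange {u L : H →L[ℂ] H} (hu : u.IsFredholm)
    (hL : FiniteDimensional ℂ L.range) : (u + L).IsFredholm := by
  obtain ⟨v, h1, h2⟩ := isFredholm_iff_exists_finiteRange.1 hu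
  refine isFredholm_iff_exists_finiteRange.2 ⟨v, ?_, ?_⟩
  · have : v * (u + L) - 1 = (v * u - 1) + v * L := by noncomm_ring
    rw [this]
    exact finiteDimensional_range_add h1 (finiteDimensional_range_mul_left hL v)
  · have : (u + L) * v - 1 = (u * v - 1) + L * v := by noncomm_ring
    rw [this]
    exact finiteDimensional_range_add h2 (finiteDimensional_range_mul_right hL v)

/-- The set of Fredholm operators is open. -/
theorem exists_isFredholm_add_of_norm_le {u : H →L[ℂ] H} (hu : u.IsFredholm) :
    ∃ ε > 0, ∀ K : H →L[ℂ] H, ‖K‖ ≤ ε → (u + K).IsFredholm := by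
  obtain ⟨v, h1, h2⟩ := isFredholm_iff_exists_finiteRange.1 hu
  have hpos : 0 < ‖v‖ + 1 := by positivity
  refine ⟨(2 * (‖v‖ + 1))⁻¹, by positivity, fun K hK => ?_⟩
  have hsmall : ‖v‖ * ‖K‖ < 1 := by
    calc ‖v‖ * ‖K‖ ≤ (‖v‖ + 1) * (2 * (‖v‖ + 1))⁻¹ := by gcongr; linarith
      _ = 1 / 2 := by field_simp
      _ < 1 := by norm_num
  have hvK : ‖-(v * K)‖ < 1 := by
    rw [norm_neg]; exact (norm_mul_le _ _).trans_lt hsmall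
  have hKv : ‖-(K * v)‖ < 1 := by
    rw [norm_neg]; exact (norm_mul_le _ _).trans_lt (by rwa [mul_comm])
  obtain ⟨g, hg⟩ := isUnit_one_sub_of_norm_lt_one hvK
  obtain ⟨g', hg'⟩ := isUnit_one_sub_of_norm_lt_one hKv
  rw [sub_neg_eq_add] at hg hg'
  -- Since (1 + vK)v = v(1 + Kv), the left and right corrections of `v` coincide, so one operator is
  -- a quasi-inverse on both sides.
  have hcomm : (↑g⁻¹ : H →L[ℂ] H) * v = v * ↑g'⁻¹ := by
    rw [Units.inv_mul_eq_iff_eq_mul, ← mul_assoc, Units.eq_mul_inv_iff_mul_eq, hg, hg']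
    noncomm_ring
  refine isFredholm_iff_exists_finiteRange.2 ⟨↑g⁻¹ * v, ?_, ?_⟩
  · have : (↑g⁻¹ : H →L[ℂ] H) * v * (u + K) - 1 = ↑g⁻¹ * (v * u - 1) := by
      have h3 : v * (u + K) = (v * u - 1) + g := by rw [hg]; noncomm_ring
      rw [mul_assoc, h3, mul_add, Units.inv_mul]
      noncomm_ring
    rw [this]
    exact finiteDimensional_range_mul_left h1 _
  · have : (u + K) * ((↑g⁻¹ : H →L[ℂ] H) * v) - 1 = (u * v - 1) * ↑g'⁻¹ := by
      have h3 : (u + K) * v = (u * v - 1) + g' := by rw [hg']; noncomm_ring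
      rw [hcomm, ← mul_assoc, h3, add_mul, Units.mul_inv]
      noncomm_ring
    rw [this]
    exact finiteDimensional_range_mul_right h2 _

/-- Split `K` into a part small enough for openness of the Fredholm set and a finite rank part. -/
theorem isFredholm_add_isCompactOperator {u K : H →L[ℂ] H} (hu : u.IsFredholm)
    (hK : IsCompactOperator K) : (u + K).IsFredholm := by
  obtain ⟨ε, hε, h⟩ := exists_isFredholm_add_of_norm_le hu
  obtain ⟨L, hL, hKL⟩ := exists_finiteRange_near hK hε
  have := isFredholm_add_finiteRange (h _ hKL) hL
  rwa [add_assoc, sub_add_cancel] at this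

theorem essSpectrum_eq_of_isCompactOperator_sub {A B : H →L[ℂ] H}
    (h : IsCompactOperator (A - B)) : essSpectrum A = essSpectrum B := by
  have key : ∀ {A B : H →L[ℂ] H}, IsCompactOperator (A - B) → essSpectrum A ⊆ essSpectrum B := by
    intro A B h z hz hB
    refine hz ?_
    have := isFredholm_add_isCompactOperator hB h
    rwa [show B - z • (1 : H →L[ℂ] H) + (A - B) = A - z • (1 : H →L[ℂ] H) by abel] at this
  refine (key h).antisymm (key ?_)
  have hneg : IsCompactOperator (-(A - B)) := h.neg
  rwa [neg_sub] at hneg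

/-- The convex set of self-adjoint compact perturbations of `F` in the unit ball. -/
def compactPerturbations (F : H →L[ℂ] H) : Set (H →L[ℂ] H) :=
  {A | IsSelfAdjoint A ∧ ‖A‖ ≤ 1 ∧ IsCompactOperator (A - F)}

theorem convex_compactPerturbations (F : H →L[ℂ] H) : Convex ℝ (compactPerturbations F) := by
  rintro A ⟨hA, hA1, hAF⟩ B ⟨hB, hB1, hBF⟩ a b ha hb hab
  refine ⟨((IsSelfAdjoint.all a).smul hA).add ((IsSelfAdjoint.all b).smul hB), ?_, ?_⟩
  · simpa using convex_closedBall (0 : H →L[ℂ] H) 1 (by simpa using hA1) (by simpa using hB1)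
      ha hb hab
  · have : (a • A + b • B - F : H →L[ℂ] H) = a • (A - F) + b • (B - F) := by
      have hF : F = (a + b) • F := by rw [hab, one_smul]
      conv_lhs => rw [hF]
      module
    rw [this]
    exact (hAF.smul a).add (hBF.smul b)

/-- The essential spectrum is unchanged by compact perturbation. In particular 1 stays in the
spectrum, so the norm cannot drop below one. -/
theorem compactPerturbations_subset_SFHat {F : H →L[ℂ] H} (hF : F ∈ SFHat H) :
    compactPerturbations F ⊆ SFHat H := by
  rintro A ⟨hA, hA1, hAF⟩
  have hess : essSpectrum A = {-1, 1} :=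
    (essSpectrum_eq_of_isCompactOperator_sub hAF).trans hF.2.2
  have h1 : (1 : ℂ) ∈ essSpectrum A := by rw [hess]; simp
  refine ⟨⟨hA, ?_, ⟨1, one_pos, by simpa using h1⟩, ⟨-1, by norm_num, by rw [hess]; simp⟩⟩, ?_,
    hess⟩
  · by_contra h0
    have : (0 : ℂ) ∈ essSpectrum A := by simpa [essSpectrum] using h0
    rw [hess] at this
    simp at this
  · refine le_antisymm hA1 ?_
    have hs : (1 : ℂ) ∈ spectrum ℂ A := by
      intro hu
      refine h1 (isFredholm_of_isUnit ?_)
      have := IsUnit.neg hu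
      simpa [Algebra.algebraMap_eq_smul_one] using this
    have h2 := spectrum.norm_le_norm_mul_of_mem hs
    have h3 : ‖(1 : H →L[ℂ] H)‖ ≤ 1 := ContinuousLinearMap.norm_id_le
    rw [norm_one] at h2
    nlinarith [norm_nonneg A]

/-- Zero is at most an isolated eigenvalue of a self-adjoint Fredholm operator. -/
theorem exists_isUnit_sub_of_isFredholm {T : H →L[ℂ] H} (hT : IsSelfAdjoint T)
    (hF : T.IsFredholm) : ∃ ε > 0, ∀ μ : ℝ, μ ≠ 0 → |μ| < ε →
      IsUnit (T - algebraMap ℝ (H →L[ℂ] H) μ) := by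
  have := hF.finite_ker
  set P : H →L[ℂ] H := T.ker.starProjection with hP
  have hPfin : FiniteDimensional ℂ P.range := by
    rw [hP, Submodule.range_starProjection]; infer_instance
  have hPsa : IsSelfAdjoint P := isSelfAdjoint_starProjection T.ker
  have hPP : P * P = P := T.ker.isIdempotentElem_starProjection
  have hTP : T * P = 0 := by
    ext x
    exact Submodule.starProjection_apply_mem T.ker x
  have hPT : P * T = 0 := by
    have := congrArg star hTP
    rwa [star_mul, hPsa.star_eq, hT.star_eq, star_zero] at this
  -- Adding the kernel projection removes the kernel; a self-adjoint Fredholm operator with trivial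
  -- kernel is bijective.
  have hG : IsUnit (T + P) := by
    have hfr : (T + P).IsFredholm := isFredholm_add_finiteRange hF hPfin
    have hsa : IsSelfAdjoint (T + P) := hT.add hPsa
    have hker : (T + P).ker = ⊥ := by
      rw [Submodule.eq_bot_iff]
      intro x hx
      have hx' : (T + P) x = 0 := hx
      have hPx : P x = 0 := by
        have : (P * (T + P)) x = 0 := by
          rw [mul_apply_eq_comp, hx', map_zero]
        rwa [mul_add, hPT, hPP, zero_add] at this
      have hTx : T x = 0 := by
        rwa [add_apply, hPx, add_zero] at hx'
      rw [← hPx]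
      exact (Submodule.starProjection_eq_self_iff.2 hTx).symm
    have hrange : (T + P).range = ⊤ := by
      have h1 : (T + P).rangeᗮ = ⊥ := by
        rw [ContinuousLinearMap.orthogonal_range, ← ContinuousLinearMap.star_eq_adjoint,
          hsa.star_eq, hker]
      have h2 : ((T + P).range).HasOrthogonalProjection :=
        have : CompleteSpace (T + P).range := hfr.isClosed_range.completeSpace_coe
        inferInstance
      exact (Submodule.orthogonal_eq_bot_iff).1 h1
    exact ContinuousLinearMap.isUnit_iff_bijective.2
      ⟨LinearMap.ker_eq_bot.1 hker, LinearMap.range_eq_top.1 hrange⟩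
  have hopen : ∀ᶠ μ : ℝ in nhds 0, IsUnit (T + P - algebraMap ℝ (H →L[ℂ] H) μ) := by
    have hc : Continuous fun μ : ℝ => T + P - algebraMap ℝ (H →L[ℂ] H) μ :=
      continuous_const.sub (continuous_algebraMap ℝ _)
    refine hc.continuousAt.eventually (Units.isOpen.mem_nhds ?_)
    simpa using hG
  obtain ⟨ε, hε, h⟩ := Metric.eventually_nhds_iff.1 hopen
  refine ⟨ε, hε, fun μ hμ0 hμ => ?_⟩
  obtain ⟨g, hg⟩ := h (y := μ) (by simpa using hμ)
  set m : H →L[ℂ] H := algebraMap ℝ (H →L[ℂ] H) μ with hm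
  set m' : H →L[ℂ] H := algebraMap ℝ (H →L[ℂ] H) μ⁻¹ with hm'
  have hmm' : m * m' = 1 := by rw [hm, hm', ← map_mul, mul_inv_cancel₀ hμ0, map_one]
  have hmc : ∀ x, m * x = x * m := fun x => Algebra.commutes μ x
  have hmc' : ∀ x, m' * x = x * m' := fun x => Algebra.commutes μ⁻¹ x
  have hgP : (g : H →L[ℂ] H) * P = P - m * P := by
    rw [hg, sub_mul, add_mul, hTP, hPP, zero_add]
  have hPg : P * (g : H →L[ℂ] H) = P - m * P := by
    rw [hg, mul_sub, mul_add, hPT, hPP, zero_add, hmc]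
  have hTm : T - m = g - P := by rw [hg]; abel
  have hPg' : P * (↑g⁻¹ : H →L[ℂ] H) = ↑g⁻¹ * P := by
    rw [Units.mul_inv_eq_iff_eq_mul, mul_assoc, hPg, ← hgP, Units.inv_mul_cancel_left]
  have hid : (T - m) * P = -(m * P) := by rw [sub_mul, hTP, zero_sub]
  have hid' : P * (T - m) = -(m * P) := by rw [mul_sub, hPT, zero_sub, hmc]
  -- The inverse is assembled blockwise: `T - m` is -μ on the kernel of `T` and agrees with `g` on
  -- its orthogonal complement.
  have hmul : (T - m) * (↑g⁻¹ * (1 - P) - m' * P) = 1 := by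
    have e1 : (T - m) * (m' * P) = -P := by
      rw [hmc', ← mul_assoc, hid, neg_mul, hmc P, mul_assoc, hmm', mul_one]
    have e2 : (T - m) * (↑g⁻¹ * (1 - P)) = 1 - P := by
      rw [hTm, sub_mul, Units.mul_inv_cancel_left, ← mul_assoc, hPg', mul_assoc, mul_sub, hPP,
        mul_one, sub_self, mul_zero, sub_zero]
    rw [mul_sub, e1, e2]; abel
  have hmul' : (↑g⁻¹ * (1 - P) - m' * P) * (T - m) = 1 := by
    have e1 : (m' * P) * (T - m) = -P := by
      rw [mul_assoc, hid', mul_neg, ← mul_assoc, hmc' m, hmm', one_mul]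
    have e2 : (↑g⁻¹ * (1 - P)) * (T - m) = 1 - P := by
      have hc : (↑g⁻¹ : H →L[ℂ] H) * (1 - P) = (1 - P) * ↑g⁻¹ := by
        rw [mul_sub, sub_mul, hPg', mul_one, one_mul]
      rw [hc, hTm, mul_assoc, mul_sub (↑g⁻¹ : H →L[ℂ] H), Units.inv_mul, ← hPg', mul_sub,
        ← mul_assoc, sub_mul 1 P P, one_mul, hPP, sub_self, zero_mul, mul_one, sub_zero]
    rw [sub_mul, e1, e2]; abel
  exact ⟨⟨_, _, hmul, hmul'⟩, rfl⟩


open Topology Filter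

/-! ### Ranks of idempotents -/

/-- If `‖p x - q x‖ < ‖x‖` on the range of `p`, then `q` is injective there. -/
theorem rank_le_of_norm_sub_lt_one {p q : H →L[ℂ] H} (hp : p * p = p)
    (hpq : ‖p - q‖ < 1) (hq : FiniteDimensional ℂ q.range) :
    FiniteDimensional ℂ p.range ∧ Module.finrank ℂ p.range ≤ Module.finrank ℂ q.range := by
  let f : p.range →ₗ[ℂ] q.range :=
    ((q : H →ₗ[ℂ] H).rangeRestrict).comp p.range.subtype
  have hf : Function.Injective f := by
    rw [← LinearMap.ker_eq_bot, Submodule.eq_bot_iff]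
    rintro ⟨x, y, hy⟩ hx
    have hqx : q x = 0 := congrArg Subtype.val hx
    have hpx : p x = x := by
      have hyx : p y = x := hy
      rw [← hyx]
      exact congrArg (fun T : H →L[ℂ] H => T y) hp
    by_contra hne
    have hx0 : 0 < ‖x‖ := norm_pos_iff.2 fun h => hne (Subtype.ext h)
    have h1 : ‖x‖ ≤ ‖p - q‖ * ‖x‖ := by
      have := (p - q).le_opNorm x
      rwa [sub_apply, hpx, hqx, sub_zero] at this
    nlinarith
  exact ⟨FiniteDimensional.of_injective f hf, LinearMap.finrank_le_finrank_of_injective hf⟩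

/-- The rank is locally constant along a continuous family of idempotents of finite rank. -/
theorem continuousWithinAt_finrank_range {X : Type*} [TopologicalSpace X] {S : Set X}
    {p : X → H →L[ℂ] H} {x : X} (hx : x ∈ S) (hcont : ContinuousWithinAt p S x)
    (hidem : ∀ y ∈ S, p y * p y = p y) (hfin : ∀ y ∈ S, FiniteDimensional ℂ (p y).range) :
    ContinuousWithinAt (fun y => (Module.finrank ℂ (p y).range : ℤ)) S x := by
  have h : ∀ᶠ y in 𝓝[S] x, ‖p y - p x‖ < 1 := by
    have := hcont.eventually (Metric.ball_mem_nhds (p x) one_pos)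
    filter_upwards [this] with y hy
    rwa [← dist_eq_norm]
  refine ContinuousWithinAt.congr_of_eventuallyEq (f := fun _ => (Module.finrank ℂ (p x).range : ℤ))
    continuousWithinAt_const ?_ rfl
  filter_upwards [h, self_mem_nhdsWithin] with y hy hyS
  have h1 := (rank_le_of_norm_sub_lt_one (hidem y hyS) hy (hfin x hx)).2
  have h2 := (rank_le_of_norm_sub_lt_one (hidem x hx) (by rwa [norm_sub_rev]) (hfin y hyS)).2
  exact_mod_cast le_antisymm h1 h2

theorem finrank_range_add {p q : H →L[ℂ] H} (hp : p * p = p) (hq : q * q = q)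
    (hpq : p * q = 0) (hqp : q * p = 0) (hpf : FiniteDimensional ℂ p.range)
    (hqf : FiniteDimensional ℂ q.range) :
    Module.finrank ℂ (p + q).range = Module.finrank ℂ p.range + Module.finrank ℂ q.range := by
  have happ : ∀ {a b : H →L[ℂ] H}, a = b → ∀ x, a x = b x := fun h x => by rw [h]
  have hsup : (p + q).range = p.range ⊔ q.range := by
    refine le_antisymm (LinearMap.range_add_le (p : H →ₗ[ℂ] H) (q : H →ₗ[ℂ] H))
      (sup_le ?_ ?_)
    · rintro _ ⟨x, rfl⟩
      refine ⟨p x, ?_⟩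
      have h1 := happ hp x
      have h2 := happ hqp x
      simp only [ContinuousLinearMap.coe_coe, add_apply, mul_apply_eq_comp, zero_apply] at h1 h2 ⊢
      rw [h1, h2, add_zero]
    · rintro _ ⟨x, rfl⟩
      refine ⟨q x, ?_⟩
      have h1 := happ hq x
      have h2 := happ hpq x
      simp only [ContinuousLinearMap.coe_coe, add_apply, mul_apply_eq_comp, zero_apply] at h1 h2 ⊢
      rw [h1, h2, zero_add]
  have hinf : p.range ⊓ q.range = ⊥ := by
    rw [Submodule.eq_bot_iff]
    rintro _ ⟨⟨x, rfl⟩, ⟨y, hy⟩⟩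
    have h1 := happ hp x
    have h2 := happ hpq y
    simp only [ContinuousLinearMap.coe_coe, mul_apply_eq_comp, zero_apply] at h1 h2 hy ⊢
    rw [hy, h1] at h2
    exact h2
  have := Submodule.finrank_sup_add_finrank_inf_eq p.range q.range
  rwa [hinf, finrank_bot, add_zero, ← hsup] at this

/-! ### Spectral subspaces -/

theorem specFamily_eq (A : H →L[ℂ] H) (c : ℝ) :
    specFamily A c = (cfc (fun x : ℝ => max (x - c) 0) A).ker.starProjection := rfl

theorem continuous_posPart_sub (c : ℝ) : Continuous fun x : ℝ => max (x - c) 0 := by fun_prop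

theorem ker_posPart_mono {A : H →L[ℂ] H} {c d : ℝ} (hcd : c ≤ d) :
    (cfc (fun x : ℝ => max (x - c) 0) A).ker ≤ (cfc (fun x : ℝ => max (x - d) 0) A).ker := by
  rcases hcd.eq_or_lt with rfl | hlt
  · exact le_rfl
  -- The denominator is at least d - c > 0 and equals x - c wherever the numerator is nonzero, so
  -- the larger cutoff is a continuous multiple of the smaller one.
  let g : ℝ → ℝ := fun x => max (x - d) 0 / max (x - c) (d - c)
  have hg : Continuous g := by
    refine (continuous_posPart_sub d).div (by fun_prop) fun x => ?_
    exact ne_of_gt (lt_max_of_lt_right (sub_pos.2 hlt))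
  have hfun : (fun x : ℝ => max (x - d) 0) = fun x => g x * max (x - c) 0 := by
    funext x
    rcases le_or_gt x d with hx | hx
    · simp [g, max_eq_right (sub_nonpos.2 hx)]
    · have h1 : max (x - d) 0 = x - d := max_eq_left (by linarith)
      have h2 : max (x - c) (d - c) = x - c := max_eq_left (by linarith)
      have h3 : max (x - c) 0 = x - c := max_eq_left (by linarith)
      have h4 : x - c ≠ 0 := by linarith
      simp only [g, h1, h2, h3]
      field_simp
  intro x hx
  have hx' : cfc (fun x : ℝ => max (x - c) 0) A x = 0 := hx
  change cfc (fun x : ℝ => max (x - d) 0) A x = 0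
  rw [hfun, cfc_mul g _ A hg.continuousOn (continuous_posPart_sub c).continuousOn,
    mul_apply_eq_comp, hx', map_zero]

theorem isStarProjection_specFamily (A : H →L[ℂ] H) (c : ℝ) :
    IsStarProjection (specFamily A c) :=
  isStarProjection_starProjection

theorem specFamily_mul_of_le (A : H →L[ℂ] H) {c d : ℝ} (hcd : c ≤ d) :
    specFamily A c * specFamily A d = specFamily A c :=
  Submodule.starProjection_comp_starProjection_of_le (ker_posPart_mono hcd)

theorem specFamily_mul_of_ge (A : H →L[ℂ] H) {c d : ℝ} (hcd : c ≤ d) :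
    specFamily A d * specFamily A c = specFamily A c := by
  have := congrArg star (specFamily_mul_of_le A hcd)
  rwa [star_mul, (isStarProjection_specFamily A c).isSelfAdjoint.star_eq,
    (isStarProjection_specFamily A d).isSelfAdjoint.star_eq] at this

theorem specFamily_mul_self (A : H →L[ℂ] H) (c : ℝ) :
    specFamily A c * specFamily A c = specFamily A c :=
  specFamily_mul_of_le A le_rfl

theorem specProj_mul_self (A : H →L[ℂ] H) {a b : ℝ} (hab : a ≤ b) :
    specProj A a b * specProj A a b = specProj A a b := by
  simp only [specProj, mul_sub, sub_mul, specFamily_mul_self, specFamily_mul_of_le A hab,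
    specFamily_mul_of_ge A hab]
  abel

theorem specProj_add (A : H →L[ℂ] H) (a b c : ℝ) :
    specProj A a b + specProj A b c = specProj A a c := by
  simp only [specProj]; abel

/-- Lets a continuous χ_{(a,b]} be cut at a regular level d even when a and b themselves lie in the
spectrum. -/
theorem specProj_mul_specFamily (A : H →L[ℂ] H) {a b d : ℝ} (had : a ≤ d) (hdb : d ≤ b) :
    specProj A a b * specFamily A d = specProj A a d := by
  simp only [specProj, sub_mul, specFamily_mul_of_ge A hdb, specFamily_mul_of_le A had]

theorem range_specProj_eq (A : H →L[ℂ] H) {a b : ℝ} (hab : a ≤ b) :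
    (specProj A a b).range = (cfc (fun x : ℝ => max (x - b) 0) A).ker ⊓
      ((cfc (fun x : ℝ => max (x - a) 0) A).ker)ᗮ := by
  ext x
  constructor
  · rintro ⟨y, rfl⟩
    have h1 : specFamily A b (specProj A a b y) = specProj A a b y := by
      have : specFamily A b * specProj A a b = specProj A a b := by
        simp only [specProj, mul_sub, specFamily_mul_self, specFamily_mul_of_ge A hab]
      exact congrArg (fun T : H →L[ℂ] H => T y) this
    have h2 : specFamily A a (specProj A a b y) = 0 := by
      have : specFamily A a * specProj A a b = 0 := by
        simp only [specProj, mul_sub, specFamily_mul_self, specFamily_mul_of_le A hab, sub_self]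
      exact congrArg (fun T : H →L[ℂ] H => T y) this
    exact ⟨Submodule.starProjection_eq_self_iff.1 h1,
      (Submodule.starProjection_apply_eq_zero_iff _).1 h2⟩
  · rintro ⟨h1, h2⟩
    refine ⟨x, ?_⟩
    have h1' : specFamily A b x = x := Submodule.starProjection_eq_self_iff.2 h1
    have h2' : specFamily A a x = 0 := (Submodule.starProjection_apply_eq_zero_iff _).2 h2
    change specFamily A b x - specFamily A a x = x
    rw [h1', h2', sub_zero]

/-! ### Spectral projections at points of the resolvent set -/

theorem continuousOn_indicator_Iic (c : ℝ) :
    ContinuousOn (indicator (Iic c) (1 : ℝ → ℝ)) {x | x ≠ c} := by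
  intro x hx
  refine ContinuousAt.continuousWithinAt ?_
  rcases lt_or_gt_of_ne hx with h | h
  · refine (continuousAt_const (y := (1 : ℝ))).congr ?_
    filter_upwards [Iio_mem_nhds h] with y hy
    rw [indicator_of_mem (mem_Iic.2 (le_of_lt hy))]; rfl
  · refine (continuousAt_const (y := (0 : ℝ))).congr ?_
    filter_upwards [Ioi_mem_nhds h] with y hy
    rw [indicator_of_notMem (by simpa using hy)]

/-- Away from the spectrum the indicator is continuous on it, which brings the kernel projection
under the continuous functional calculus and gives norm continuity in `A`. -/
theorem specFamily_eq_cfc {A : H →L[ℂ] H} (hA : IsSelfAdjoint A) {c : ℝ}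
    (hc : c ∉ spectrum ℝ A) : specFamily A c = cfc (indicator (Iic c) (1 : ℝ → ℝ)) A := by
  have hsub : spectrum ℝ A ⊆ {x | x ≠ c} := fun x hx h => hc (h ▸ hx)
  set χ : ℝ → ℝ := indicator (Iic c) (1 : ℝ → ℝ) with hχ
  have hcont : ContinuousOn χ (spectrum ℝ A) := (continuousOn_indicator_Iic c).mono hsub
  set p := cfc χ A with hp
  have hidem : p * p = p := by
    rw [hp, ← cfc_mul χ χ A hcont hcont]
    congr 1
    funext x
    by_cases hx : x ∈ Iic c <;> simp [hχ, hx]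
  have hsp : IsStarProjection p := ⟨hidem, cfc_predicate χ A⟩
  have hf : ContinuousOn (fun x : ℝ => max (x - c) 0) (spectrum ℝ A) :=
    (continuous_posPart_sub c).continuousOn
  have hrange : p.range = (cfc (fun x : ℝ => max (x - c) 0) A).ker := by
    apply le_antisymm
    · rintro _ ⟨y, rfl⟩
      have hz : cfc (fun x : ℝ => max (x - c) 0) A * p = 0 := by
        rw [hp, ← cfc_mul _ χ A hf hcont, ← cfc_zero ℝ A]
        congr 1
        funext x
        by_cases hx : x ∈ Iic c
        · have : max (x - c) 0 = 0 := max_eq_right (sub_nonpos.2 hx)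
          simp [this]
        · simp [hχ, hx]
      exact congrArg (fun T : H →L[ℂ] H => T y) hz
    · intro x hx
      -- Factoring 1 - χ through the positive part shows that `1 - p` kills the kernel; the quotient
      -- is continuous on the spectrum because c is not in it.
      let g : ℝ → ℝ := fun y => (1 - χ y) / (y - c)
      have hg : ContinuousOn g (spectrum ℝ A) :=
        (continuousOn_const.sub hcont).div (by fun_prop) fun y hy => sub_ne_zero.2 (hsub hy)
      have hz : 1 - p = cfc g A * cfc (fun x : ℝ => max (x - c) 0) A := by
        rw [hp, ← cfc_mul g _ A hg hf, ← cfc_const_one ℝ A, ← cfc_sub _ χ A continuousOn_const hcont]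
        refine cfc_congr fun y hy => ?_
        have hyc : y - c ≠ 0 := sub_ne_zero.2 (hsub hy)
        by_cases hy' : y ≤ c
        · simp [g, hχ, hy']
        · have : max (y - c) 0 = y - c := max_eq_left (by linarith)
          simp [g, hχ, hy', this, hyc]
      have hx' : cfc (fun x : ℝ => max (x - c) 0) A x = 0 := hx
      have : (1 - p) x = 0 := by rw [hz, mul_apply_eq_comp, hx', map_zero]
      refine ⟨x, ?_⟩
      exact (sub_eq_zero.1 this).symm
  obtain ⟨_, h⟩ := isStarProjection_iff_eq_starProjection_range.1 hsp
  rw [specFamily_eq, h]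
  congr! 1
  exact hrange.symm

theorem continuousOn_specFamily (c : ℝ) :
    ContinuousOn (fun A : H →L[ℂ] H => specFamily A c)
      {A | IsSelfAdjoint A ∧ c ∉ spectrum ℝ A} := by
  have h : ContinuousOn (fun A : H →L[ℂ] H => cfc (indicator (Iic c) (1 : ℝ → ℝ)) A)
      {A | IsSelfAdjoint A ∧ c ∉ spectrum ℝ A} := by
    refine ContinuousOn.cfc_of_mem_nhdsSet (s := {x | x ≠ c}) _ ?_ continuousOn_id
      (fun A hA => hA.1) (continuousOn_indicator_Iic c)
    refine isOpen_ne.mem_nhdsSet.2 ?_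
    intro x hx h
    obtain ⟨A, hA, hxA⟩ := mem_iUnion₂.1 hx
    exact hA.2 (h ▸ hxA)
  exact h.congr fun A hA => specFamily_eq_cfc hA.1 hA.2

theorem isOpen_notMem_spectrum (c : ℝ) : IsOpen {A : H →L[ℂ] H | c ∉ spectrum ℝ A} := by
  have : {A : H →L[ℂ] H | c ∉ spectrum ℝ A} =
      (fun A => algebraMap ℝ (H →L[ℂ] H) c - A) ⁻¹' {T | IsUnit T} := by
    ext A
    simp [spectrum.mem_iff]
  rw [this]
  exact Units.isOpen.preimage (by fun_prop)

/-! ### Operators with essential spectrum `{-1, 1}` -/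

theorem isolated_of_mem_SFHat {A : H →L[ℂ] H} (hA : A ∈ SFHat H) {t : ℝ} (ht : t ∈ Ioo (-1 : ℝ) 1) :
    FiniteDimensional ℂ (A - (t : ℂ) • (1 : H →L[ℂ] H)).ker ∧
      ∃ ε > 0, ∀ c : ℝ, c ≠ t → |c - t| < ε → c ∉ spectrum ℝ A := by
  have hfr : (A - (t : ℂ) • (1 : H →L[ℂ] H)).IsFredholm := by
    by_contra h
    have h1 : (t : ℂ) ∈ essSpectrum A := h
    rw [hA.2.2] at h1
    rcases h1 with h1 | h1
    · exact ht.1.ne' (by exact_mod_cast h1)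
    · exact ht.2.ne (by exact_mod_cast mem_singleton_iff.1 h1)
  refine ⟨hfr.finite_ker, ?_⟩
  have heq : (t : ℂ) • (1 : H →L[ℂ] H) = algebraMap ℝ (H →L[ℂ] H) t := by
    rw [Algebra.algebraMap_eq_smul_one]
    exact Complex.coe_smul t (1 : H →L[ℂ] H)
  have hsa : IsSelfAdjoint (A - (t : ℂ) • (1 : H →L[ℂ] H)) := by
    rw [heq]
    exact hA.1.1.sub (IsSelfAdjoint.algebraMap _ (IsSelfAdjoint.all t))
  obtain ⟨ε, hε, h⟩ := exists_isUnit_sub_of_isFredholm hsa hfr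
  refine ⟨ε, hε, fun c hc hct => ?_⟩
  have h1 := (h (c - t) (sub_ne_zero.2 hc) hct).neg
  rw [spectrum.mem_iff, not_not]
  convert h1 using 1
  rw [heq, map_sub]
  abel

theorem exists_regular_mem_Ioo {A : H →L[ℂ] H} (hA : A ∈ SFHat H) {a b : ℝ} (ha : -1 ≤ a)
    (hab : a < b) (hb : b ≤ 1) : ∃ c ∈ Ioo a b, c ∉ spectrum ℝ A := by
  have ht : (a + b) / 2 ∈ Ioo (-1 : ℝ) 1 := ⟨by linarith, by linarith⟩
  obtain ⟨-, ε, hε, h⟩ := isolated_of_mem_SFHat hA ht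
  have hδ : 0 < min (ε / 2) ((b - a) / 4) := lt_min (by linarith) (by linarith)
  have h1 := min_le_left (ε / 2) ((b - a) / 4)
  have h2 := min_le_right (ε / 2) ((b - a) / 4)
  refine ⟨(a + b) / 2 + min (ε / 2) ((b - a) / 4), ⟨by linarith, by linarith⟩, h _ (by linarith) ?_⟩
  rw [add_sub_cancel_left, abs_of_pos hδ]
  linarith

theorem range_specProj_mono (A : H →L[ℂ] H) {a b c d : ℝ} (hab : a ≤ b) (hbc : b ≤ c)
    (hcd : c ≤ d) : (specProj A b c).range ≤ (specProj A a d).range := by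
  rw [range_specProj_eq A hbc, range_specProj_eq A (hab.trans (hbc.trans hcd))]
  exact inf_le_inf (ker_posPart_mono hcd) (Submodule.orthogonal_le (ker_posPart_mono hab))

/-- Finite rank of χ between x and y is a symmetric, transitive relation on the levels. It holds
locally, so connectedness of (-1, 1) spreads it to all pairs. -/
theorem finiteDimensional_specProj {A : H →L[ℂ] H} (hA : A ∈ SFHat H) {a b : ℝ}
    (ha : a ∈ Ioo (-1 : ℝ) 1) (hb : b ∈ Ioo (-1 : ℝ) 1) :
    FiniteDimensional ℂ (specProj A a b).range := by
  have hsymm : ∀ x y : ℝ, FiniteDimensional ℂ (specProj A x y).range →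
      FiniteDimensional ℂ (specProj A y x).range := by
    intro x y h
    have : (specProj A y x).range = (specProj A x y).range := by
      have h1 : specProj A y x = -specProj A x y := by simp [specProj]
      rw [h1]
      exact LinearMap.range_neg (specProj A x y : H →ₗ[ℂ] H)
    rwa [this]
  refine isPreconnected_Ioo.induction₂ (fun x y => FiniteDimensional ℂ (specProj A x y).range)
    ?_ ?_ (fun x y _ _ => hsymm x y) ha hb
  · intro t ht
    obtain ⟨hker, ε, hε, hreg⟩ := isolated_of_mem_SFHat hA ht
    have hfin : FiniteDimensional ℂ (specProj A (t - ε / 2) (t + ε / 2)).range := by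
      have hr1 : t - ε / 2 ∉ spectrum ℝ A :=
        hreg _ (by linarith) (by rw [abs_lt]; constructor <;> linarith)
      have hr2 : t + ε / 2 ∉ spectrum ℝ A :=
        hreg _ (by linarith) (by rw [abs_lt]; constructor <;> linarith)
      have hc1 := (continuousOn_indicator_Iic (t - ε / 2)).mono
        (fun x (hx : x ∈ spectrum ℝ A) (h : x = t - ε / 2) => hr1 (h ▸ hx))
      have hc2 := (continuousOn_indicator_Iic (t + ε / 2)).mono
        (fun x (hx : x ∈ spectrum ℝ A) (h : x = t + ε / 2) => hr2 (h ▸ hx))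
      -- Only t itself can be spectrum in this window, so the range lies in the finite-dimensional
      -- eigenspace at t.
      have hzero : (A - (t : ℂ) • (1 : H →L[ℂ] H)) * specProj A (t - ε / 2) (t + ε / 2) = 0 := by
        have h1 : A - (t : ℂ) • (1 : H →L[ℂ] H) = cfc (fun x : ℝ => x - t) A := by
          rw [cfc_sub (fun x => x) (fun _ => t) A, cfc_id' ℝ A hA.1.1, cfc_const t A hA.1.1,
            Algebra.algebraMap_eq_smul_one]
          rfl
        rw [h1, specProj, specFamily_eq_cfc hA.1.1 hr1, specFamily_eq_cfc hA.1.1 hr2,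
          ← cfc_sub _ _ A hc2 hc1, ← cfc_mul (fun x : ℝ => x - t) (fun x => indicator (Iic (t + ε / 2)) (1 : ℝ → ℝ) x -
            indicator (Iic (t - ε / 2)) (1 : ℝ → ℝ) x) A (by fun_prop) (hc2.sub hc1),
          ← cfc_zero ℝ A]
        refine cfc_congr fun x hx => ?_
        rcases eq_or_ne x t with rfl | hxt
        · simp
        · have hx' : ε ≤ |x - t| := by
            by_contra hlt
            exact hreg x hxt (not_le.1 hlt) hx
          rcases le_abs.1 hx' with h | h
          · have e1 : ¬ x ≤ t - ε / 2 := by linarith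
            have e2 : ¬ x ≤ t + ε / 2 := by linarith
            simp [e1, e2]
          · have e1 : x ≤ t - ε / 2 := by linarith
            have e2 : x ≤ t + ε / 2 := by linarith
            simp [e1, e2]
      refine Submodule.finiteDimensional_of_le (S₂ := (A - (t : ℂ) • (1 : H →L[ℂ] H)).ker) ?_
      rintro _ ⟨y, rfl⟩
      exact congrArg (fun T : H →L[ℂ] H => T y) hzero
    have hnear : ∀ᶠ y in 𝓝[Ioo (-1 : ℝ) 1] t, y ∈ Ioo (t - ε / 2) (t + ε / 2) :=
      mem_nhdsWithin_of_mem_nhds (Ioo_mem_nhds (by linarith) (by linarith))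
    filter_upwards [hnear] with y hy
    rcases le_total t y with h | h
    · exact Submodule.finiteDimensional_of_le
        (range_specProj_mono A (by linarith : t - ε / 2 ≤ t) h hy.2.le)
    · exact hsymm _ _ (Submodule.finiteDimensional_of_le
        (range_specProj_mono A hy.1.le h (by linarith : t ≤ t + ε / 2)))
  · intro x y z _ _ _ hxy hyz
    rw [← specProj_add A x y z]
    exact finiteDimensional_range_add hxy hyz

theorem specRank_add {A : H →L[ℂ] H} (hA : A ∈ SFHat H) {a b c : ℝ} (ha : -1 < a) (hab : a ≤ b)
    (hbc : b ≤ c) (hc : c < 1) :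
    specRank A a c = specRank A a b + specRank A b c := by
  have h1 : specProj A a b * specProj A b c = 0 := by
    simp only [specProj, mul_sub, sub_mul, specFamily_mul_self, specFamily_mul_of_le A hab,
      specFamily_mul_of_le A hbc, specFamily_mul_of_le A (hab.trans hbc)]
    abel
  have h2 : specProj A b c * specProj A a b = 0 := by
    simp only [specProj, mul_sub, sub_mul, specFamily_mul_self, specFamily_mul_of_ge A hab,
      specFamily_mul_of_ge A hbc, specFamily_mul_of_ge A (hab.trans hbc)]
    abel
  simp only [specRank]
  rw [← specProj_add A a b c]
  exact finrank_range_add (specProj_mul_self A hab) (specProj_mul_self A hbc) h1 h2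
    (finiteDimensional_specProj hA ⟨ha, by linarith⟩ ⟨by linarith, by linarith⟩)
    (finiteDimensional_specProj hA ⟨by linarith, by linarith⟩ ⟨by linarith, hc⟩)

theorem continuousWithinAt_specFamily {X : Type*} [TopologicalSpace X] {S : Set X}
    {γ : X → H →L[ℂ] H} {x : X} (hx : x ∈ S) (hγ : ContinuousWithinAt γ S x)
    (hS : ∀ y ∈ S, IsSelfAdjoint (γ y)) {c : ℝ} (hc : c ∉ spectrum ℝ (γ x)) :
    ContinuousWithinAt (fun y => specFamily (γ y) c) S x := by
  have h1 : ContinuousWithinAt (fun A : H →L[ℂ] H => specFamily A c) {A | IsSelfAdjoint A}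
      (γ x) := by
    have := continuousOn_specFamily (H := H) c (γ x) ⟨hS x hx, hc⟩
    refine this.mono_of_mem_nhdsWithin ?_
    rw [Set.ofPred_and]
    exact inter_mem self_mem_nhdsWithin
      (mem_nhdsWithin_of_mem_nhds ((isOpen_notMem_spectrum c).mem_nhds hc))
  exact h1.comp hγ hS

/-! ### Locally exact integer cocycles on convex sets -/

/-- A Lebesgue number argument. Equal parts are used because subdivisions into N and M parts have
the common refinement into N * M parts. -/
theorem exists_uniform_partition {ι : Type*} (c : ι → Set ℝ)
    (hc : ∀ s ∈ Icc (0 : ℝ) 1, ∃ i, c i ∈ 𝓝[Icc 0 1] s) :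
    ∃ N : ℕ, 0 < N ∧ ∃ i : ℕ → ι, ∀ k < N, Icc ((k : ℝ) / N) ((k + 1 : ℕ) / N) ⊆ c (i k) := by
  obtain ⟨δ, hδ, hball⟩ := lebesgue_number_lemma_of_metric (isCompact_Icc (a := (0 : ℝ)) (b := 1))
    (c := fun i => interior {x | x ∈ Icc (0 : ℝ) 1 → x ∈ c i}) (fun i => isOpen_interior)
    (fun s hs => by
      obtain ⟨i, hi⟩ := hc s hs
      exact mem_iUnion.2 ⟨i, mem_interior_iff_mem_nhds.2 (mem_inf_principal.1 hi)⟩)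
  obtain ⟨n, hn⟩ := exists_nat_one_div_lt hδ
  have hN : (0 : ℝ) < (n + 1 : ℕ) := by positivity
  have hmem : ∀ k < n + 1, ∃ i, Metric.ball ((k : ℝ) / (n + 1 : ℕ)) δ ⊆
      {x | x ∈ Icc (0 : ℝ) 1 → x ∈ c i} := by
    intro k hk
    have hkN : (k : ℝ) ≤ (n + 1 : ℕ) := by exact_mod_cast hk.le
    obtain ⟨i, hi⟩ := hball ((k : ℝ) / (n + 1 : ℕ)) ⟨by positivity, (div_le_one hN).2 hkN⟩
    exact ⟨i, hi.trans interior_subset⟩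
  have : Nonempty ι := ⟨(hmem 0 n.succ_pos).choose⟩
  choose! i hi using hmem
  refine ⟨n + 1, n.succ_pos, i, fun k hk s hs => hi k hk ?_ ⟨?_, ?_⟩⟩
  · rw [Metric.mem_ball, Real.dist_eq, abs_of_nonneg (by linarith [hs.1])]
    have h1 : ((k + 1 : ℕ) : ℝ) / (n + 1 : ℕ) = (k : ℝ) / (n + 1 : ℕ) + 1 / (n + 1) := by
      push_cast; ring
    have h2 := hs.2
    rw [h1] at h2
    linarith
  · exact le_trans (by positivity) hs.1
  · refine hs.2.trans ((div_le_one hN).2 ?_)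
    exact_mod_cast hk

theorem sum_range_blocks (g : ℕ → ℕ → ℤ) (N : ℕ) {M : ℕ} (hM : 0 < M) :
    ∑ k ∈ Finset.range (N * M), (g (k / M) k - g (k / M) (k + 1)) =
      ∑ n ∈ Finset.range N, (g n (n * M) - g n ((n + 1) * M)) := by
  induction N with
  | zero => simp
  | succ N ih =>
    rw [Nat.succ_mul, Finset.sum_range_add, ih, Finset.sum_range_succ]
    congr 1
    have : ∀ m ∈ Finset.range M, g ((N * M + m) / M) (N * M + m) -
        g ((N * M + m) / M) (N * M + m + 1) = g N (N * M + m) - g N (N * M + (m + 1)) := by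
      intro m hm
      have h : (N * M + m) / M = N := by
        rw [mul_comm, Nat.mul_add_div hM, Nat.div_eq_of_lt (Finset.mem_range.1 hm), add_zero]
      rw [h, add_assoc]
    rw [Finset.sum_congr rfl this, Finset.sum_range_sub' (fun m => g N (N * M + m)), add_zero]
    congr 2
    ring

section Potential

variable {E ι : Type*} (V : ι → Set E) (R : ι → E → ℤ)

/-- The path `p` on the `k`-th of `N` equal parts of `[0, 1]` lies in the chart `V (i k)`. -/
def IsChain (p : ℝ → E) (N : ℕ) (i : ℕ → ι) : Prop :=
  ∀ k < N, ∀ s ∈ Icc ((k : ℝ) / N) ((k + 1 : ℕ) / N), p s ∈ V (i k)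

/-- The variation of the local functions `R` along a chain. -/
def chainSum (p : ℝ → E) (N : ℕ) (i : ℕ → ι) : ℤ :=
  ∑ k ∈ Finset.range N, (R (i k) (p ((k : ℝ) / N)) - R (i k) (p ((k + 1 : ℕ) / N)))

variable {V R}

theorem IsChain.refine {p : ℝ → E} {N : ℕ} {i : ℕ → ι} (h : IsChain V p N i) {M : ℕ}
    (hM : 0 < M) : IsChain V p (N * M) (fun k => i (k / M)) := by
  intro k hk s hs
  have hN : 0 < N := Nat.pos_of_ne_zero fun h0 => by simp [h0] at hk
  have hNR : (0 : ℝ) < N := by exact_mod_cast hN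
  have hMR : (0 : ℝ) < M := by exact_mod_cast hM
  refine h (k / M) ((Nat.div_lt_iff_lt_mul hM).2 hk) s ⟨?_, ?_⟩
  · refine le_trans ?_ hs.1
    rw [div_le_div_iff₀ hNR (by exact_mod_cast Nat.mul_pos hN hM)]
    have : ((k / M : ℕ) : ℝ) * M ≤ k := by exact_mod_cast Nat.div_mul_le_self k M
    push_cast
    nlinarith
  · refine hs.2.trans ?_
    rw [div_le_div_iff₀ (by exact_mod_cast Nat.mul_pos hN hM) hNR]
    have : ((k + 1 : ℕ) : ℝ) ≤ ((k / M + 1 : ℕ) : ℝ) * M := by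
      exact_mod_cast Nat.lt_mul_of_div_lt (Nat.lt_succ_self (k / M)) hM
    push_cast at this ⊢
    nlinarith

theorem chainSum_refine (p : ℝ → E) {N : ℕ} (hN : 0 < N) (i : ℕ → ι) {M : ℕ} (hM : 0 < M) :
    chainSum R p (N * M) (fun k => i (k / M)) = chainSum R p N i := by
  have hNR : (N : ℝ) ≠ 0 := by exact_mod_cast hN.ne'
  have hMR : (M : ℝ) ≠ 0 := by exact_mod_cast hM.ne'
  have hdiv : ∀ n : ℕ, ((n * M : ℕ) : ℝ) / ((N * M : ℕ) : ℝ) = n / N := by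
    intro n
    push_cast
    exact mul_div_mul_right _ _ hMR
  unfold chainSum
  rw [sum_range_blocks (fun n k => R (i n) (p ((k : ℝ) / (N * M : ℕ)))) N hM]
  refine Finset.sum_congr rfl fun n _ => ?_
  simp only [hdiv]

/-- On each piece of the common refinement the difference of the two local functions is continuous
and integer valued, hence constant. -/
theorem chainSum_unique [TopologicalSpace E] {K : Set E}
    (hR : ∀ i j, ∀ x ∈ K, x ∈ V i → x ∈ V j → ContinuousWithinAt (fun y => R i y - R j y) K x)
    {p : ℝ → E} (hp : ContinuousOn p (Icc 0 1)) (hpK : MapsTo p (Icc 0 1) K)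
    {N M : ℕ} (hN : 0 < N) (hM : 0 < M) {i j : ℕ → ι} (hi : IsChain V p N i)
    (hj : IsChain V p M j) : chainSum R p N i = chainSum R p M j := by
  rw [← chainSum_refine p hN i hM, ← chainSum_refine p hM j hN, mul_comm M N]
  have hi' := hi.refine hM
  have hj' := hj.refine hN
  rw [mul_comm M N] at hj'
  have hNM : (0 : ℝ) < (N * M : ℕ) := by exact_mod_cast Nat.mul_pos hN hM
  unfold chainSum
  refine Finset.sum_congr rfl fun k hk => ?_
  have hk' := Finset.mem_range.1 hk
  have hle : (k : ℝ) / (N * M : ℕ) ≤ (k + 1 : ℕ) / (N * M : ℕ) := by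
    gcongr; simp
  have hsub : Icc ((k : ℝ) / (N * M : ℕ)) ((k + 1 : ℕ) / (N * M : ℕ)) ⊆ Icc (0 : ℝ) 1 := by
    refine Icc_subset_Icc (by positivity) ((div_le_one hNM).2 ?_)
    exact_mod_cast hk'
  have hc : ContinuousOn (fun s => R (i (k / M)) (p s) - R (j (k / N)) (p s))
      (Icc ((k : ℝ) / (N * M : ℕ)) ((k + 1 : ℕ) / (N * M : ℕ))) := by
    intro s hs
    exact (hR _ _ (p s) (hpK (hsub hs)) (hi' k hk' s hs) (hj' k hk' s hs)).comp
      ((hp s (hsub hs)).mono hsub) (hpK.mono_left hsub)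
  have := isPreconnected_Icc.constant hc (left_mem_Icc.2 hle) (right_mem_Icc.2 hle)
  linarith

end Potential

/-- On a convex set, a locally exact integer cocycle has a primitive. -/
theorem exists_potential {E ι : Type*} [NormedAddCommGroup E] [NormedSpace ℝ E] {V : ι → Set E}
    {R : ι → E → ℤ} {K : Set E} (hK : Convex ℝ K) (hV : ∀ i, IsOpen (V i))
    (hcov : ∀ x ∈ K, ∃ i, x ∈ V i)
    (hR : ∀ i j, ∀ x ∈ K, x ∈ V i → x ∈ V j → ContinuousWithinAt (fun y => R i y - R j y) K x) :
    ∃ φ : E → ℤ, ∀ i, ∀ x ∈ K, x ∈ V i → ContinuousWithinAt (fun y => φ y + R i y) K x := by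
  rcases K.eq_empty_or_nonempty with rfl | ⟨x₀, hx₀⟩
  · exact ⟨0, by simp⟩
  let p : E → ℝ → E := fun y s => AffineMap.lineMap x₀ y s
  have hpc2 : Continuous fun z : E × ℝ => p z.1 z.2 := by
    simp only [p, AffineMap.lineMap_apply_module]
    fun_prop
  have hp : ∀ y, Continuous (p y) := fun y => hpc2.comp (by fun_prop : Continuous fun s => (y, s))
  have hpK : ∀ y ∈ K, MapsTo (p y) (Icc 0 1) K := fun y hy s hs => hK.lineMap_mem hx₀ hy hs
  -- The potential at y is the chain sum along the segment from `x₀` to y.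
  have hex : ∀ y : E, ∃ m : ℤ, y ∈ K → ∀ (N : ℕ) (i : ℕ → ι), 0 < N → IsChain V (p y) N i →
      chainSum R (p y) N i = m := by
    intro y
    by_cases h : ∃ (N : ℕ) (i : ℕ → ι), 0 < N ∧ IsChain V (p y) N i
    · obtain ⟨M, j, hM, hj⟩ := h
      exact ⟨chainSum R (p y) M j, fun hy N i hN hi =>
        chainSum_unique hR (hp y).continuousOn (hpK y hy) hN hM hi hj⟩
    · exact ⟨0, fun _ N i hN hi => absurd ⟨N, i, hN, hi⟩ h⟩
  choose φ hφ using hex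
  refine ⟨φ, fun j x hx hxj => ?_⟩
  obtain ⟨N, hN, i₀, hi₀⟩ := exists_uniform_partition (fun i => p x ⁻¹' V i) fun s hs => by
    obtain ⟨i, hi⟩ := hcov _ (hpK x hx hs)
    exact ⟨i, mem_nhdsWithin_of_mem_nhds (((hV i).preimage (hp x)).mem_nhds hi)⟩
  have hNR : (0 : ℝ) < N := by exact_mod_cast hN
  -- Index N, beyond the last piece, carries the chart `j` under study, so the change of chart at
  -- the end point is treated like those at interior nodes.
  let i : ℕ → ι := fun k => if k < N then i₀ k else j
  have hiN : i N = j := by simp [i]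
  have hchain : IsChain V (p x) N i := by
    intro k hk s hs
    simp only [i, if_pos hk]
    exact hi₀ k hk hs
  have hpx1 : p x 1 = x := AffineMap.lineMap_apply_one _ _
  have hnode : ∀ k < N, ((k + 1 : ℕ) : ℝ) / N ∈ Icc (0 : ℝ) 1 := fun k hk =>
    ⟨by positivity, (div_le_one hNR).2 (by exact_mod_cast hk)⟩
  -- By compactness of the pieces, the chain chosen for x also serves all nearby y.
  have hev1 : ∀ᶠ y in 𝓝 x, IsChain V (p y) N i := by
    have : ∀ᶠ y in 𝓝 x, ∀ k ∈ Finset.range N,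
        ∀ s ∈ Icc ((k : ℝ) / N) ((k + 1 : ℕ) / N), p y s ∈ V (i k) := by
      rw [eventually_all_finset]
      intro k hk
      refine isCompact_Icc.eventually_forall_of_forall_eventually fun s hs => ?_
      exact hpc2.continuousAt.eventually
        ((hV _).mem_nhds (hchain k (Finset.mem_range.1 hk) s hs))
    filter_upwards [this] with y hy k hk
    exact hy k (Finset.mem_range.2 hk)
  have hev2 : ∀ᶠ y in 𝓝[K] x, ∀ k ∈ Finset.range N,
      R (i k) (p y ((k + 1 : ℕ) / N)) - R (i (k + 1)) (p y ((k + 1 : ℕ) / N)) =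
      R (i k) (p x ((k + 1 : ℕ) / N)) - R (i (k + 1)) (p x ((k + 1 : ℕ) / N)) := by
    rw [eventually_all_finset]
    intro k hk
    have hk := Finset.mem_range.1 hk
    have hmem1 : p x ((k + 1 : ℕ) / N) ∈ V (i k) :=
      hchain k hk _ (right_mem_Icc.2 (by gcongr; simp))
    have hmem2 : p x ((k + 1 : ℕ) / N) ∈ V (i (k + 1)) := by
      rcases (Nat.succ_le_of_lt hk).lt_or_eq with h | h
      · exact hchain (k + 1) h _ (left_mem_Icc.2 (by gcongr; simp))
      · have h' : k + 1 = N := h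
        rw [h', hiN, div_self hNR.ne', hpx1]
        exact hxj
    have hc : ContinuousWithinAt (fun y => p y ((k + 1 : ℕ) / N)) K x :=
      (hpc2.comp (by fun_prop : Continuous fun y : E => (y, ((k + 1 : ℕ) : ℝ) / N))).continuousWithinAt
    have := (hR (i k) (i (k + 1)) _ (hpK x hx (hnode k hk)) hmem1 hmem2).comp
      (f := fun y => p y ((k + 1 : ℕ) / N)) hc (fun y hy => hpK y hy (hnode k hk))
    exact (this.eventually (mem_nhds_discrete.2 rfl)).mono fun _ h => h.symm
  refine ContinuousWithinAt.congr_of_eventuallyEq (f := fun _ => φ x + R j x)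
    continuousWithinAt_const ?_ rfl
  filter_upwards [mem_nhdsWithin_of_mem_nhds hev1, hev2, self_mem_nhdsWithin] with y h1 h2 hy
  rw [← hφ y hy N i hN h1, ← hφ x hx N i hN hchain]
  -- Because the chart changes agree for x and y, the difference of chain sums telescopes; the
  -- initial term vanishes since all segments start at `x₀`.
  let d : ℕ → ℤ := fun k => R (i k) (p y ((k : ℝ) / N)) - R (i k) (p x ((k : ℝ) / N))
  have hsum : chainSum R (p y) N i - chainSum R (p x) N i =
      ∑ k ∈ Finset.range N, (d k - d (k + 1)) := by
    unfold chainSum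
    rw [← Finset.sum_sub_distrib]
    refine Finset.sum_congr rfl fun k hk => ?_
    have := h2 k hk
    simp only [d]
    linarith
  rw [Finset.sum_range_sub'] at hsum
  have hd0 : d 0 = 0 := by simp [d, p]
  have hdN : d N = R j y - R j x := by
    simp only [d, hiN, div_self hNR.ne', p, AffineMap.lineMap_apply_one]
  rw [hd0, hdN] at hsum
  linarith

/-! ### Existence and uniqueness of the spectral flow -/

theorem continuousWithinAt_specRank {X : Type*} [TopologicalSpace X] {S : Set X}
    {γ : X → H →L[ℂ] H} {x : X} (hx : x ∈ S) (hS : ∀ y ∈ S, γ y ∈ SFHat H) {a b : ℝ}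
    (ha : -1 < a) (hab : a ≤ b) (hb : b < 1)
    (hcont : ContinuousWithinAt (fun y => specProj (γ y) a b) S x) :
    ContinuousWithinAt (fun y => (specRank (γ y) a b : ℤ)) S x :=
  continuousWithinAt_finrank_range hx hcont (fun _ _ => specProj_mul_self _ hab)
    fun y hy => finiteDimensional_specProj (hS y hy) ⟨ha, by linarith⟩ ⟨by linarith, hb⟩

/-- A primitive of the spectral flow on the compact perturbations of `F`. -/
theorem exists_spectralPotential {F : H →L[ℂ] H} (hF : F ∈ SFHat H) :
    ∃ φ : (H →L[ℂ] H) → ℤ, ∀ A ∈ compactPerturbations F, ∀ a ∈ Ioo (-1 : ℝ) 0,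
      a ∉ spectrum ℝ A →
      ContinuousWithinAt (fun B => φ B + specRank B a 0) (compactPerturbations F) A := by
  have hsub := compactPerturbations_subset_SFHat hF
  -- The difference is the rank of χ_{(a,b]}, which is norm continuous near `A` because both levels
  -- are regular.
  have key : ∀ a b : ℝ, -1 < a → a ≤ b → b < 0 → ∀ A ∈ compactPerturbations F,
      a ∉ spectrum ℝ A → b ∉ spectrum ℝ A →
      ContinuousWithinAt (fun B => (specRank B a 0 : ℤ) - specRank B b 0)
        (compactPerturbations F) A := by
    intro a b ha hab hb A hA haA hbA
    have hfam : ∀ c, c ∉ spectrum ℝ A →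
        ContinuousWithinAt (fun B : H →L[ℂ] H => specFamily B c) (compactPerturbations F) A :=
      fun c hc => continuousWithinAt_specFamily (γ := id) hA continuousWithinAt_id
        (fun B hB => hB.1) hc
    have h := continuousWithinAt_specRank (γ := id) hA (fun B hB => hsub hB) ha hab
      (by linarith) ((hfam b hbA).sub (hfam a haA))
    refine h.congr_of_mem (fun B hB => ?_) hA
    rw [specRank_add (hsub hB) ha hab hb.le one_pos]
    simp
  obtain ⟨φ, hφ⟩ := exists_potential (ι := Ioo (-1 : ℝ) 0)
    (V := fun a => {A : H →L[ℂ] H | (a : ℝ) ∉ spectrum ℝ A})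
    (R := fun a A => (specRank A a 0 : ℤ)) (convex_compactPerturbations F)
    (fun a => isOpen_notMem_spectrum _)
    (fun A hA => by
      obtain ⟨a, ha, haA⟩ := exists_regular_mem_Ioo (hsub hA) le_rfl neg_one_lt_zero zero_le_one
      exact ⟨⟨a, ha⟩, haA⟩)
    (fun a b A hA ha hb => by
      rcases le_total (a : ℝ) b with h | h
      · exact key a b a.2.1 h b.2.2 A hA ha hb
      · exact (key b a b.2.1 h a.2.2 A hA hb ha).neg.congr_of_mem (fun B _ => by simp) hA)
  exact ⟨φ, fun A hA a ha haA => hφ ⟨a, ha⟩ A hA haA⟩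

theorem hasSpectralFlow_eq {F : H →L[ℂ] H} (hF : F ∈ SFHat H) {φ : (H →L[ℂ] H) → ℤ}
    (hφ : ∀ A ∈ compactPerturbations F, ∀ a ∈ Ioo (-1 : ℝ) 0, a ∉ spectrum ℝ A →
      ContinuousWithinAt (fun B => φ B + specRank B a 0) (compactPerturbations F) A)
    {γ : ℝ → H →L[ℂ] H} {α β : ℝ} (hγ : ContinuousOn γ (Icc α β))
    (hK : ∀ t ∈ Icc α β, γ t ∈ compactPerturbations F) {m : ℤ}
    (h : HasSpectralFlow γ α β m) : m = φ (γ β) - φ (γ α) := by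
  obtain ⟨N, s, a, b, hs, hs0, hsN, hab, rfl⟩ := h
  have hsub := compactPerturbations_subset_SFHat hF
  have hstep : ∀ n : Fin N, ((specRank (γ (s n.castSucc)) (a n) 0 : ℤ) -
      specRank (γ (s n.succ)) (a n) 0) = φ (γ (s n.succ)) - φ (γ (s n.castSucc)) := by
    intro n
    obtain ⟨ha1, ha0, hb0, hb1, hcont, -⟩ := hab n
    have hle : s n.castSucc ≤ s n.succ := (hs n.castSucc_lt_succ).le
    have hJ : Icc (s n.castSucc) (s n.succ) ⊆ Icc α β := by
      rw [← hs0, ← hsN]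
      exact Icc_subset_Icc (hs.monotone (Fin.zero_le _)) (hs.monotone (Fin.le_last _))
    have hc : ContinuousOn (fun t => φ (γ t) + specRank (γ t) (a n) 0)
        (Icc (s n.castSucc) (s n.succ)) := by
      intro t ht
      -- The level `a n` may be spectral, so φ does not control it directly. A regular d in between
      -- splits the rank into a part governed by φ and the rank of a continuous χ_{(a n, d]}.
      obtain ⟨d, hd, hdt⟩ := exists_regular_mem_Ioo (hsub (hK t (hJ ht))) ha1.le ha0 zero_le_one
      have hγt : ContinuousWithinAt γ (Icc (s n.castSucc) (s n.succ)) t := (hγ t (hJ ht)).mono hJ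
      have h1 : ContinuousWithinAt (fun t => φ (γ t) + specRank (γ t) d 0)
          (Icc (s n.castSucc) (s n.succ)) t :=
        (hφ (γ t) (hK t (hJ ht)) d ⟨ha1.trans hd.1, hd.2⟩ hdt).comp (f := γ) hγt
          fun y hy => hK y (hJ hy)
      have h2 : ContinuousWithinAt (fun t => specProj (γ t) (a n) d)
          (Icc (s n.castSucc) (s n.succ)) t := by
        exact ((hcont t ht).mul (continuousWithinAt_specFamily ht hγt
          (fun y hy => (hK y (hJ hy)).1) hdt)).congr_of_mem
          (fun y _ => (specProj_mul_specFamily _ hd.1.le (hd.2.trans hb0).le).symm) ht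
      have h3 := continuousWithinAt_specRank ht (fun y hy => hsub (hK y (hJ hy))) ha1 hd.1.le
        (hd.2.trans one_pos) h2
      refine (h1.add h3).congr_of_mem (fun y hy => ?_) ht
      rw [specRank_add (hsub (hK y (hJ hy))) ha1 hd.1.le hd.2.le one_pos]
      simp only [Nat.cast_add, Pi.add_apply]
      ring
    have := isPreconnected_Icc.constant hc (left_mem_Icc.2 hle) (right_mem_Icc.2 hle)
    linarith
  rw [Finset.sum_congr rfl fun n _ => hstep n, ← hs0, ← hsN]
  have hsum := Fin.sum_univ_succ fun k => φ (γ (s k))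
  rw [Fin.sum_univ_castSucc] at hsum
  rw [Finset.sum_sub_distrib]
  linarith

theorem exists_hasSpectralFlow {γ : ℝ → H →L[ℂ] H} {α β : ℝ} (hαβ : α < β)
    (hγ : ContinuousOn γ (Icc α β)) (hS : ∀ t ∈ Icc α β, γ t ∈ SFHat H) :
    ∃ m, HasSpectralFlow γ α β m := by
  let σ : ℝ → ℝ := fun u => α + (β - α) * u
  have hσc : Continuous σ := by fun_prop
  have hσm : StrictMono σ := fun u v huv => by
    simp only [σ]
    nlinarith
  have hσ0 : σ 0 = α := by simp [σ]
  have hσ1 : σ 1 = β := by simp [σ]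
  have hσI : MapsTo σ (Icc 0 1) (Icc α β) := fun u hu =>
    ⟨hσ0 ▸ hσm.monotone hu.1, hσ1 ▸ hσm.monotone hu.2⟩
  obtain ⟨N, hN, i, hi⟩ := exists_uniform_partition
    (fun i : Ioo (-1 : ℝ) 0 × Ioo (0 : ℝ) 1 =>
      {u | (i.1 : ℝ) ∉ spectrum ℝ (γ (σ u)) ∧ (i.2 : ℝ) ∉ spectrum ℝ (γ (σ u))})
    (fun u hu => by
      have hA := hS _ (hσI hu)
      obtain ⟨a, ha, haA⟩ := exists_regular_mem_Ioo hA le_rfl neg_one_lt_zero zero_le_one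
      obtain ⟨b, hb, hbA⟩ := exists_regular_mem_Ioo hA neg_one_lt_zero.le one_pos le_rfl
      have hc : ContinuousWithinAt (fun u => γ (σ u)) (Icc 0 1) u :=
        (hγ _ (hσI hu)).comp hσc.continuousWithinAt hσI
      exact ⟨⟨⟨a, ha⟩, ⟨b, hb⟩⟩, (hc.eventually ((isOpen_notMem_spectrum a).mem_nhds haA)).and
        (hc.eventually ((isOpen_notMem_spectrum b).mem_nhds hbA))⟩)
  have hNR : (0 : ℝ) < N := by exact_mod_cast hN
  refine ⟨_, N, fun k => σ ((k : ℕ) / N), fun k => (i k).1, fun k => (i k).2, ?_, ?_, ?_, ?_, rfl⟩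
  · intro k l hkl
    refine hσm ?_
    gcongr
    exact hkl
  · simp [hσ0]
  · simp [div_self hNR.ne', hσ1]
  · intro n
    have hle : ((n : ℕ) : ℝ) / N ≤ ((n : ℕ) + 1 : ℕ) / N := by gcongr; simp
    have hsub01 : Icc (((n : ℕ) : ℝ) / N) (((n : ℕ) + 1 : ℕ) / N) ⊆ Icc 0 1 :=
      Icc_subset_Icc (by positivity) ((div_le_one hNR).2 (by exact_mod_cast n.2))
    have hJ : ∀ t ∈ Icc (σ (((n : ℕ) : ℝ) / N)) (σ (((n : ℕ) + 1 : ℕ) / N)),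
        ∃ u ∈ Icc (((n : ℕ) : ℝ) / N) (((n : ℕ) + 1 : ℕ) / N), σ u = t := fun t ht =>
      intermediate_value_Icc hle hσc.continuousOn ht
    have hmem : ∀ t ∈ Icc (σ (((n : ℕ) : ℝ) / N)) (σ (((n : ℕ) + 1 : ℕ) / N)), t ∈ Icc α β ∧
        ((i n).1 : ℝ) ∉ spectrum ℝ (γ t) ∧ ((i n).2 : ℝ) ∉ spectrum ℝ (γ t) := by
      intro t ht
      obtain ⟨u, hu, rfl⟩ := hJ t ht
      exact ⟨hσI (hsub01 hu), hi n n.2 hu⟩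
    have h1 := (i n).1.2
    have h2 := (i n).2.2
    have hcont : ContinuousOn (fun t => specProj (γ t) (i n).1 (i n).2)
        (Icc (σ (((n : ℕ) : ℝ) / N)) (σ (((n : ℕ) + 1 : ℕ) / N))) := by
      intro t ht
      have hγt := (hγ t (hmem t ht).1).mono fun y hy => (hmem y hy).1
      exact (continuousWithinAt_specFamily ht hγt (fun y hy => (hS y (hmem y hy).1).1.1)
        (hmem t ht).2.2).sub (continuousWithinAt_specFamily ht hγt
          (fun y hy => (hS y (hmem y hy).1).1.1) (hmem t ht).2.1)
    refine ⟨h1.1, h1.2, h2.1, h2.2, hcont, specRank (γ (σ (((n : ℕ) : ℝ) / N))) (i n).1 (i n).2,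
      fun t ht => ⟨finiteDimensional_specProj (hS t (hmem t ht).1) ⟨h1.1, h1.2.trans one_pos⟩
        ⟨neg_one_lt_zero.trans h2.1, h2.2⟩, ?_⟩⟩
    have hrank : ContinuousOn (fun t => (specRank (γ t) (i n).1 (i n).2 : ℤ))
        (Icc (σ (((n : ℕ) : ℝ) / N)) (σ (((n : ℕ) + 1 : ℕ) / N))) := fun y hy =>
      continuousWithinAt_specRank hy (fun z hz => hS z (hmem z hz).1) h1.1 (h1.2.trans h2.1).le
        h2.2 (hcont y hy)
    exact_mod_cast isPreconnected_Icc.constant hrank ht (left_mem_Icc.2 (hσm.monotone hle))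

/-! ### Conjugation by an antiunitary operator -/

/-- Polarization: antilinearity exchanges the two terms carrying ±i. -/
theorem inner_map_map_conj (C : H ≃ₗᵢ⋆[ℂ] H) (x y : H) : inner ℂ (C x) (C y) = inner ℂ y x := by
  rw [← inner_conj_symm y x, inner_eq_sum_norm_sq_div_four (𝕜 := ℂ) (C x) (C y),
    inner_eq_sum_norm_sq_div_four (𝕜 := ℂ) x y]
  have h1 : ‖C x + C y‖ = ‖x + y‖ := by rw [← map_add, C.norm_map]
  have h2 : ‖C x - C y‖ = ‖x - y‖ := by rw [← map_sub, C.norm_map]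
  have hI : (RCLike.I : ℂ) • C y = -C ((RCLike.I : ℂ) • y) := by
    rw [C.map_smulₛₗ, RCLike.conj_I, neg_smul, neg_neg]
  have h3 : ‖C x - (RCLike.I : ℂ) • C y‖ = ‖x + (RCLike.I : ℂ) • y‖ := by
    rw [hI, sub_neg_eq_add, ← map_add, C.norm_map]
  have h4 : ‖C x + (RCLike.I : ℂ) • C y‖ = ‖x - (RCLike.I : ℂ) • y‖ := by
    rw [hI, ← sub_eq_add_neg, ← map_sub, C.norm_map]
  rw [h1, h2, h3, h4]
  simp only [map_div₀, map_add, map_sub, map_mul, map_pow, RCLike.conj_ofReal, RCLike.conj_I,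
    map_ofNat]
  ring

variable {C : H ≃ₗᵢ⋆[ℂ] H}

theorem conjOp_apply (C : H ≃ₗᵢ⋆[ℂ] H) (T : H →L[ℂ] H) (x : H) : conjOp C T x = C (T (C x)) := rfl

theorem conjOp_mul (hC : ∀ x, C (C x) = x) (S T : H →L[ℂ] H) :
    conjOp C (S * T) = conjOp C S * conjOp C T := by
  apply ContinuousLinearMap.ext
  intro x
  simp only [conjOp_apply, mul_apply_eq_comp, hC]

theorem conjOp_conjOp (hC : ∀ x, C (C x) = x) (T : H →L[ℂ] H) : conjOp C (conjOp C T) = T := by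
  apply ContinuousLinearMap.ext
  intro x
  simp only [conjOp_apply, hC]

theorem conjOp_star (hC : ∀ x, C (C x) = x) (T : H →L[ℂ] H) :
    conjOp C (star T) = star (conjOp C T) := by
  rw [ContinuousLinearMap.star_eq_adjoint, ContinuousLinearMap.star_eq_adjoint,
    ContinuousLinearMap.eq_adjoint_iff]
  intro x y
  rw [conjOp_apply, conjOp_apply]
  conv_lhs => rw [← hC y]
  conv_rhs => rw [← hC x]
  rw [inner_map_map_conj, inner_map_map_conj, ContinuousLinearMap.adjoint_inner_right]

theorem transposeOp_of_isSelfAdjoint (C : H ≃ₗᵢ⋆[ℂ] H) (hC : ∀ x, C (C x) = x) {T : H →L[ℂ] H}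
    (hT : IsSelfAdjoint T) : transposeOp C T = conjOp C T := by
  rw [transposeOp, ← conjOp_star hC, hT.star_eq]

/-- The real star-algebra endomorphism `T ↦ W* (C T C) W`. -/
def antiConj (C : H ≃ₗᵢ⋆[ℂ] H) (hC : ∀ x, C (C x) = x) (W : unitary (H →L[ℂ] H)) :
    (H →L[ℂ] H) →⋆ₐ[ℝ] (H →L[ℂ] H) where
  toFun T := star (W : H →L[ℂ] H) * conjOp C T * W
  map_one' := by
    have : conjOp C (1 : H →L[ℂ] H) = 1 := ContinuousLinearMap.ext hC
    rw [this, mul_one, Unitary.coe_star_mul_self]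
  map_zero' := by
    have : conjOp C (0 : H →L[ℂ] H) = 0 :=
      ContinuousLinearMap.ext fun x => map_zero C
    rw [this, mul_zero, zero_mul]
  map_mul' S T := by
    rw [conjOp_mul hC]
    simp only [mul_assoc]
    rw [← mul_assoc (W : H →L[ℂ] H) (star (W : H →L[ℂ] H)), Unitary.mul_star_self_of_mem W.2, one_mul]
  map_add' S T := by
    have : conjOp C (S + T) = conjOp C S + conjOp C T :=
      ContinuousLinearMap.ext fun x => map_add C _ _
    rw [this, mul_add, add_mul]
  commutes' r := by
    have : conjOp C (algebraMap ℝ (H →L[ℂ] H) r) = algebraMap ℝ (H →L[ℂ] H) r := by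
      apply ContinuousLinearMap.ext
      intro x
      rw [conjOp_apply, Algebra.algebraMap_eq_smul_one]
      change C ((r : ℝ) • C x) = r • x
      rw [← Complex.coe_smul, C.map_smulₛₗ, hC, Complex.conj_ofReal, Complex.coe_smul]
    rw [this, mul_assoc, Algebra.commutes, ← mul_assoc, Unitary.coe_star_mul_self, one_mul]
  map_star' T := by
    rw [conjOp_star hC]
    simp only [star_mul, star_star, mul_assoc]

theorem antiConj_apply (hC : ∀ x, C (C x) = x) (W : unitary (H →L[ℂ] H)) (T : H →L[ℂ] H) :
    antiConj C hC W T = star (W : H →L[ℂ] H) * conjOp C T * W := rfl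

theorem continuous_antiConj (hC : ∀ x, C (C x) = x) (W : unitary (H →L[ℂ] H)) :
    Continuous (antiConj C hC W) := by
  have hadd : ∀ T, ‖antiConj C hC W T‖ ≤ 1 * ‖T‖ := by
    intro T
    rw [antiConj_apply, mul_assoc, one_mul, ← Unitary.coe_star, CStarRing.norm_coe_unitary_mul,
      CStarRing.norm_mul_coe_unitary]
    refine ContinuousLinearMap.opNorm_le_bound _ (norm_nonneg _) fun x => ?_
    rw [conjOp_apply, C.norm_map]
    exact (T.le_opNorm _).trans_eq (by rw [C.norm_map])
  exact AddMonoidHomClass.continuous_of_bound (antiConj C hC W) 1 hadd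

/-- Operators fixed by `antiConj` commute with the antiunitary `C W`. -/
theorem comm_of_antiConj_eq (hC : ∀ x, C (C x) = x) {W : unitary (H →L[ℂ] H)} {T : H →L[ℂ] H}
    (hT : antiConj C hC W T = T) (x : H) :
    T (C ((W : H →L[ℂ] H) x)) = C ((W : H →L[ℂ] H) (T x)) := by
  have h1 : (W : H →L[ℂ] H) * T = conjOp C T * W := by
    conv_lhs => rw [← hT, antiConj_apply]
    rw [← mul_assoc, ← mul_assoc, Unitary.mul_star_self_of_mem W.2, one_mul]
  have h2 : (W : H →L[ℂ] H) (T x) = C (T (C ((W : H →L[ℂ] H) x))) :=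
    congrArg (fun S : H →L[ℂ] H => S x) h1
  rw [h2, hC]

theorem antiConj_antiConj (hC : ∀ x, C (C x) = x) {W : unitary (H →L[ℂ] H)}
    (hW : conjOp C W * (W : H →L[ℂ] H) = -1) (T : H →L[ℂ] H) :
    antiConj C hC W (antiConj C hC W T) = T := by
  have hW' : star (W : H →L[ℂ] H) * star (conjOp C W) = -1 := by
    rw [← star_mul, hW, star_neg, star_one]
  rw [antiConj_apply, antiConj_apply, conjOp_mul hC, conjOp_mul hC, conjOp_conjOp hC,
    conjOp_star hC, mul_assoc, mul_assoc, hW, ← mul_assoc, ← mul_assoc, hW']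
  simp

/-! ### Kramers degeneracy -/

/-- A finite-dimensional complex vector space with a quaternionic structure has even dimension. -/
theorem even_finrank_of_antilinear {V : Type*} [AddCommGroup V] [Module ℂ V]
    [FiniteDimensional ℂ V] (J : V →ₛₗ[starRingEnd ℂ] V) (hJ : ∀ v, J (J v) = -v) :
    Even (Module.finrank ℂ V) := by
  let b := Module.finBasis ℂ V
  let M : Matrix (Fin (Module.finrank ℂ V)) (Fin (Module.finrank ℂ V)) ℂ :=
    fun i j => b.repr (J (b j)) i
  -- In a basis J² = -1 reads M M̄ = -1; determinants give |det M|² = (-1)ⁿ, impossible for odd n.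
  have hM : M * (starRingEnd ℂ).mapMatrix M = -1 := by
    ext k j
    have h1 : J (b j) = ∑ i, M i j • b i := (b.sum_repr (J (b j))).symm
    have h2 := hJ (b j)
    rw [h1, map_sum] at h2
    simp only [LinearMap.map_smulₛₗ] at h2
    have h3 := congrArg (fun v => b.repr v k) h2
    simp only [map_sum, map_smul, map_neg, Finsupp.coe_finsetSum, Finset.sum_apply,
      Finsupp.coe_smul, Pi.smul_apply, Finsupp.coe_neg, Pi.neg_apply, smul_eq_mul,
      Module.Basis.repr_self] at h3
    rw [Matrix.mul_apply, Matrix.neg_apply, Matrix.one_apply]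
    simp only [RingHom.mapMatrix_apply, Matrix.map_apply]
    rw [Finsupp.single_apply] at h3
    simp only [eq_comm (a := k)]
    rw [← h3]
    exact Finset.sum_congr rfl fun i _ => mul_comm _ _
  have hdet := congrArg Matrix.det hM
  rw [Matrix.det_mul, ← RingHom.map_det, Matrix.det_neg, Matrix.det_one, mul_one,
    Complex.mul_conj, Fintype.card_fin] at hdet
  by_contra hodd
  rw [Nat.not_even_iff_odd] at hodd
  rw [hodd.neg_one_pow] at hdet
  have h : Complex.normSq M.det = -1 := by exact_mod_cast hdet
  linarith [Complex.normSq_nonneg M.det]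

/-- The antiunitary J = CW commutes with `A`, hence with its real continuous functions. It therefore
preserves their kernels and orthogonal complements, and restricts to a quaternionic structure on the
spectral subspace. -/
theorem even_specRank {A : H →L[ℂ] H} (hA : A ∈ SFHat H) (hC : ∀ x, C (C x) = x)
    {W : unitary (H →L[ℂ] H)} (hW : conjOp C W * (W : H →L[ℂ] H) = -1)
    (hAW : antiConj C hC W A = A) {a : ℝ} (ha : -1 < a) (ha0 : a ≤ 0) :
    Even (specRank A a 0) := by
  have hJJ : ∀ x, C ((W : H →L[ℂ] H) (C ((W : H →L[ℂ] H) x))) = -x := fun x =>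
    congrArg (fun S : H →L[ℂ] H => S x) hW
  have hker : ∀ c : ℝ, ∀ x ∈ (cfc (fun x : ℝ => max (x - c) 0) A).ker,
      C ((W : H →L[ℂ] H) x) ∈ (cfc (fun x : ℝ => max (x - c) 0) A).ker := by
    intro c x hx
    have hcfc : antiConj C hC W (cfc (fun x : ℝ => max (x - c) 0) A) =
        cfc (fun x : ℝ => max (x - c) 0) A := by
      rw [StarAlgHom.map_cfc (antiConj C hC W) _ A (continuous_posPart_sub c).continuousOn
        (continuous_antiConj hC W) hA.1.1 (by rw [hAW]; exact hA.1.1), hAW]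
    have hx' : cfc (fun x : ℝ => max (x - c) 0) A x = 0 := hx
    change cfc (fun x : ℝ => max (x - c) 0) A _ = 0
    rw [comm_of_antiConj_eq hC hcfc, hx', map_zero, map_zero]
  have hinner : ∀ x y, inner ℂ (C ((W : H →L[ℂ] H) x)) (C ((W : H →L[ℂ] H) y)) = inner ℂ y x := by
    intro x y
    rw [inner_map_map_conj]
    exact ContinuousLinearMap.inner_map_map_of_mem_unitary W.2 y x
  have horth : ∀ c : ℝ, ∀ x ∈ ((cfc (fun x : ℝ => max (x - c) 0) A).ker)ᗮ,
      C ((W : H →L[ℂ] H) x) ∈ ((cfc (fun x : ℝ => max (x - c) 0) A).ker)ᗮ := by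
    intro c x hx
    rw [Submodule.mem_orthogonal] at hx ⊢
    intro u hu
    -- Writing u as -J(Ju) moves J off x: ⟨u, Jx⟩ = -⟨x, Ju⟩.
    have h1 := hinner (C ((W : H →L[ℂ] H) u)) x
    rw [hJJ, inner_neg_left] at h1
    have h2 := hx _ (hker c u hu)
    rw [← inner_conj_symm x, h2, map_zero] at h1
    exact neg_eq_zero.1 h1
  have hfin := finiteDimensional_specProj hA (a := a) (b := 0) ⟨ha, by linarith⟩ ⟨by norm_num, one_pos⟩
  rw [specRank]
  rw [range_specProj_eq A ha0] at hfin ⊢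
  exact even_finrank_of_antilinear
    { toFun := fun x => ⟨C ((W : H →L[ℂ] H) x), hker 0 x x.2.1, horth a x x.2.2⟩
      map_add' := fun x y => Subtype.ext (by simp)
      map_smul' := fun r x => Subtype.ext (by simp [C.map_smulₛₗ]) }
    (fun x => Subtype.ext (hJJ x))

/-- The segment from `A` to `B` stays fixed by `antiConj`, which is real linear. Along it φ plus an
even rank is locally constant, so φ mod 2 is constant. -/
theorem potential_emod_two_eq {F : H →L[ℂ] H} (hF : F ∈ SFHat H) {φ : (H →L[ℂ] H) → ℤ}
    (hφ : ∀ A ∈ compactPerturbations F, ∀ a ∈ Ioo (-1 : ℝ) 0, a ∉ spectrum ℝ A →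
      ContinuousWithinAt (fun B => φ B + specRank B a 0) (compactPerturbations F) A)
    (hC : ∀ x, C (C x) = x) {W : unitary (H →L[ℂ] H)}
    (hW : conjOp C W * (W : H →L[ℂ] H) = -1) {A B : H →L[ℂ] H}
    (hA : A ∈ compactPerturbations F) (hAW : antiConj C hC W A = A)
    (hB : B ∈ compactPerturbations F) (hBW : antiConj C hC W B = B) :
    φ A % 2 = φ B % 2 := by
  have hsub := compactPerturbations_subset_SFHat hF
  let p : ℝ → H →L[ℂ] H := fun t => (1 - t) • A + t • B
  have hp : Continuous p := by fun_prop
  have hpK : MapsTo p (Icc 0 1) (compactPerturbations F) := fun t ht =>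
    convex_compactPerturbations F hA hB (sub_nonneg.2 ht.2) ht.1 (sub_add_cancel 1 t)
  have hpW : ∀ t, antiConj C hC W (p t) = p t := fun t => by
    simp only [p, map_add, map_smul, hAW, hBW]
  have hc : ContinuousOn (fun t => φ (p t) % 2) (Icc 0 1) := by
    intro t ht
    obtain ⟨a, ha, hat⟩ := exists_regular_mem_Ioo (hsub (hpK ht)) le_rfl neg_one_lt_zero zero_le_one
    have h1 : ContinuousWithinAt (fun t => φ (p t) + specRank (p t) a 0) (Icc 0 1) t :=
      (hφ (p t) (hpK ht) a ha hat).comp (f := p) hp.continuousWithinAt hpK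
    have h2 : ContinuousWithinAt (fun t => (φ (p t) + specRank (p t) a 0) % 2) (Icc 0 1) t :=
      (continuous_of_discreteTopology (f := fun m : ℤ => m % 2)).continuousAt.comp_continuousWithinAt
        h1
    refine h2.congr_of_mem (fun y hy => ?_) ht
    obtain ⟨k, hk⟩ := even_specRank (hsub (hpK hy)) hC hW (hpW y) ha.1 ha.2.le
    rw [hk]
    push_cast
    omega
  have := isPreconnected_Icc.constant hc (left_mem_Icc.2 zero_le_one) (right_mem_Icc.2 zero_le_one)
  simpa [p] using this

/-! ### The set `Θ(F, U, I)` -/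

theorem hasSpectralFlow_SF {γ : ℝ → H →L[ℂ] H} {α β : ℝ} (h : ∃ m, HasSpectralFlow γ α β m) :
    HasSpectralFlow γ α β (SF γ α β) := by
  rw [SF, dif_pos h]
  exact h.choose_spec

/-- The adjoint of the odd symmetry relation gives Ū I = I U*, so I Ū I U = I² U* U = -1. This is J²
= -1 for J = CIU. -/
theorem conjOp_mul_self_eq_neg_one (hC : ∀ x, C (C x) = x) {I U : H →L[ℂ] H}
    (hI : I ∈ unitary (H →L[ℂ] H)) (hI_real : conjOp C I = I) (hI_sq : I * I = -1)
    (hU : U ∈ unitary (H →L[ℂ] H))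
    (hU_odd : IsOddSymmetric C I U) : conjOp C (I * U) * (I * U) = -1 := by
  have h : conjOp C U * I = I * star U := by
    have h1 := congrArg star hU_odd
    simp only [transposeOp, star_mul, star_star] at h1
    rw [← h1, ← mul_assoc, Unitary.mul_star_self_of_mem hI, one_mul]
  rw [conjOp_mul hC, hI_real, mul_assoc, ← mul_assoc (conjOp C U), h, mul_assoc I,
    Unitary.star_mul_self_of_mem hU, mul_one, hI_sq]

theorem antiConj_eq_of_isOddSymmetric (hC : ∀ x, C (C x) = x) {I F : H →L[ℂ] H}
    (hF : IsSelfAdjoint F) (hF_odd : IsOddSymmetric C I F) {U : H →L[ℂ] H}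
    {W : unitary (H →L[ℂ] H)} (hW : (W : H →L[ℂ] H) = I * U) :
    antiConj C hC W F = star U * F * U := by
  rw [IsOddSymmetric, transposeOp_of_isSelfAdjoint C hC hF] at hF_odd
  rw [antiConj_apply, hW, star_mul]
  conv_rhs => rw [← hF_odd]
  simp only [mul_assoc]

theorem conj_mem_compactPerturbations {F U : H →L[ℂ] H} (hF : F ∈ SFHat H)
    (hU : U ∈ unitary (H →L[ℂ] H)) (hFU : IsCompactOperator (F * U - U * F)) :
    star U * F * U ∈ compactPerturbations F := by
  refine ⟨hF.1.1.conjugate' U, ?_, ?_⟩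
  · rw [CStarRing.norm_mul_mem_unitary _ hU, CStarRing.norm_mem_unitary_mul _ (Unitary.star_mem hU),
      hF.2.1]
  · have : star U * F * U - F = star U * (F * U - U * F) := by
      rw [mul_sub, ← mul_assoc, ← mul_assoc, Unitary.star_mul_self_of_mem hU, one_mul]
    rw [this]
    exact hFU.clm_comp (star U)

theorem linPath_eq {F U : H →L[ℂ] H} (hU : U ∈ unitary (H →L[ℂ] H)) (s : ℝ) :
    linPath F U s = (1 - s) • F + s • (star U * F * U) := by
  have h1 : star U * (F * U - U * F) = star U * F * U - F := by
    rw [mul_sub, ← mul_assoc, ← mul_assoc, Unitary.star_mul_self_of_mem hU, one_mul]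
  have h2 : linPath F U s = F + s • (star U * F * U - F) := by
    rw [← h1]; rfl
  rw [h2]
  module

theorem mem_compactPerturbations_of_mem_Theta {I F U : H →L[ℂ] H} {γ : ℝ → H →L[ℂ] H}
    (hγ : γ ∈ Theta C I F U) {s : ℝ} (hs : s ∈ Icc (0 : ℝ) 1) : γ s ∈ compactPerturbations F :=
  ⟨(hγ.2.1 s hs).1.1, (hγ.2.1 s hs).2.1.le, hγ.2.2.2.1 s hs⟩

/-- The path is the segment from F to U*FU; the real linear involution `antiConj` swaps its ends and
so reverses it. -/
theorem linPath_mem_Theta (hC : ∀ x, C (C x) = x)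
    {I : H →L[ℂ] H} (hI : I ∈ unitary (H →L[ℂ] H)) (hI_real : conjOp C I = I) (hI_sq : I * I = -1)
    {F : H →L[ℂ] H} (hF : F ∈ SFHat H) (hF_odd : IsOddSymmetric C I F)
    {U : H →L[ℂ] H} (hU : U ∈ unitary (H →L[ℂ] H)) (hU_odd : IsOddSymmetric C I U)
    (hFU : IsCompactOperator (F * U - U * F)) : linPath F U ∈ Theta C I F U := by
  let W : unitary (H →L[ℂ] H) := ⟨I * U, mul_mem hI hU⟩
  have hW : conjOp C W * (W : H →L[ℂ] H) = -1 :=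
    conjOp_mul_self_eq_neg_one hC hI hI_real hI_sq hU hU_odd
  have hFW : antiConj C hC W F = star U * F * U :=
    antiConj_eq_of_isOddSymmetric hC hF.1.1 hF_odd rfl
  have hGW : antiConj C hC W (star U * F * U) = F := by
    rw [← hFW, antiConj_antiConj hC hW]
  have hFK : F ∈ compactPerturbations F := by
    refine ⟨hF.1.1, hF.2.1.le, ?_⟩
    rw [sub_self]
    exact isCompactOperator_zero
  have hK : ∀ s ∈ Icc (0 : ℝ) 1, linPath F U s ∈ compactPerturbations F := fun s hs => by
    rw [linPath_eq hU]
    exact convex_compactPerturbations F hFK (conj_mem_compactPerturbations hF hU hFU)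
      (sub_nonneg.2 hs.2) hs.1 (sub_add_cancel 1 s)
  refine ⟨?_, fun s hs => compactPerturbations_subset_SFHat hF (hK s hs), ?_,
    fun s hs => (hK s hs).2.2, fun s hs => ?_⟩
  · have : linPath F U = fun s : ℝ => (1 - s) • F + s • (star U * F * U) := funext (linPath_eq hU)
    rw [this]
    fun_prop
  · rw [linPath_eq hU]; simp
  · rw [transposeOp_of_isSelfAdjoint C hC (hK s hs).1]
    change _ = antiConj C hC W (linPath F U s)
    rw [linPath_eq hU, linPath_eq hU, map_add, map_smul, map_smul, hFW, hGW, sub_sub_cancel,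
      add_comm]

theorem isCompactOperator_commutator_of_mem_Theta (hC : ∀ x, C (C x) = x)
    {I : H →L[ℂ] H} (hI : I ∈ unitary (H →L[ℂ] H)) {F : H →L[ℂ] H} (hF : F ∈ SFHat H)
    (hF_odd : IsOddSymmetric C I F) {U : H →L[ℂ] H} (hU : U ∈ unitary (H →L[ℂ] H))
    {γ : ℝ → H →L[ℂ] H} (hγ : γ ∈ Theta C I F U) : IsCompactOperator (F * U - U * F) := by
  have h0 : (0 : ℝ) ∈ Icc (0 : ℝ) 1 := left_mem_Icc.2 zero_le_one
  have h1 : (1 : ℝ) ∈ Icc (0 : ℝ) 1 := right_mem_Icc.2 zero_le_one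
  -- The symmetry at s = 0 and the odd symmetry of F determine the end point.
  have hγ1 : γ 1 = star U * F * U := by
    have h := hγ.2.2.2.2 0 h0
    rw [sub_zero, hγ.2.2.1, transposeOp_of_isSelfAdjoint C hC hF.1.1] at h
    rw [h]
    exact antiConj_eq_of_isOddSymmetric hC (W := ⟨I * U, mul_mem hI hU⟩) hF.1.1 hF_odd rfl
  have hc := hγ.2.2.2.1 1 h1
  have : F * U - U * F = U * (γ 1 - F) := by
    rw [hγ1, mul_sub, ← mul_assoc, ← mul_assoc, Unitary.mul_star_self_of_mem hU, one_mul]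
  rw [this]
  exact hc.clm_comp U

theorem SF_emod_two_eq (hC : ∀ x, C (C x) = x)
    {I : H →L[ℂ] H} (hI : I ∈ unitary (H →L[ℂ] H)) (hI_real : conjOp C I = I) (hI_sq : I * I = -1)
    {F : H →L[ℂ] H} (hF : F ∈ SFHat H)
    {U : H →L[ℂ] H} (hU : U ∈ unitary (H →L[ℂ] H)) (hU_odd : IsOddSymmetric C I U) :
    (∀ γ ∈ Theta C I F U, ∃! m : ℤ, HasSpectralFlow γ 0 (1 / 2) m) ∧
    (∀ γ ∈ Theta C I F U, ∀ γ' ∈ Theta C I F U,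
      ((SF γ 0 (1 / 2) : ℤ) : ZMod 2) = (SF γ' 0 (1 / 2) : ℤ)) := by
  let W : unitary (H →L[ℂ] H) := ⟨I * U, mul_mem hI hU⟩
  have hW : conjOp C W * (W : H →L[ℂ] H) = -1 :=
    conjOp_mul_self_eq_neg_one hC hI hI_real hI_sq hU hU_odd
  obtain ⟨φ, hφ⟩ := exists_spectralPotential hF
  have hsub : Icc (0 : ℝ) (1 / 2) ⊆ Icc 0 1 := Icc_subset_Icc_right (by norm_num)
  have hhalf : (1 / 2 : ℝ) ∈ Icc (0 : ℝ) 1 := ⟨by norm_num, by norm_num⟩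
  have heq : ∀ γ ∈ Theta C I F U, ∀ m, HasSpectralFlow γ 0 (1 / 2) m → m = φ (γ (1 / 2)) - φ F := by
    intro γ hγ m hm
    have := hasSpectralFlow_eq hF hφ (hγ.1.mono hsub)
      (fun t ht => mem_compactPerturbations_of_mem_Theta hγ (hsub ht)) hm
    rwa [hγ.2.2.1] at this
  have hex : ∀ γ ∈ Theta C I F U, ∃ m, HasSpectralFlow γ 0 (1 / 2) m := fun γ hγ =>
    exists_hasSpectralFlow (by norm_num) (hγ.1.mono hsub) fun t ht => hγ.2.1 t (hsub ht)
  -- The reflection s ↦ 1 - s fixes 1/2, so Kramers degeneracy applies at the midpoint.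
  have hsymm : ∀ γ ∈ Theta C I F U, antiConj C hC W (γ (1 / 2)) = γ (1 / 2) := by
    intro γ hγ
    have h := hγ.2.2.2.2 (1 / 2) hhalf
    rw [transposeOp_of_isSelfAdjoint C hC (hγ.2.1 _ hhalf).1.1,
      show (1 - 1 / 2 : ℝ) = 1 / 2 by norm_num] at h
    exact h.symm
  refine ⟨fun γ hγ => ?_, fun γ hγ γ' hγ' => ?_⟩
  · obtain ⟨m, hm⟩ := hex γ hγ
    exact ⟨m, hm, fun n hn => (heq γ hγ n hn).trans (heq γ hγ m hm).symm⟩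
  · have h := potential_emod_two_eq hF hφ hC hW
      (mem_compactPerturbations_of_mem_Theta hγ hhalf) (hsymm γ hγ)
      (mem_compactPerturbations_of_mem_Theta hγ' hhalf) (hsymm γ' hγ')
    rw [heq γ hγ _ (hasSpectralFlow_SF (hex γ hγ)), heq γ' hγ' _ (hasSpectralFlow_SF (hex γ' hγ'))]
    refine (ZMod.intCast_eq_intCast_iff _ _ 2).2 ?_
    exact Int.ModEq.sub_right _ h

end

end SpectralFlow

theorem mainTheorem3 {H : Type*} [NormedAddCommGroup H] [InnerProductSpace ℂ H] [CompleteSpace H]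
    [TopologicalSpace.SeparableSpace H]
    -- a complex conjugation and a real unitary with square `-1`
    (C : H ≃ₗᵢ⋆[ℂ] H) (hC : ∀ x, C (C x) = x)
    (I : H →L[ℂ] H) (hI_unitary : I ∈ unitary (H →L[ℂ] H))
    (hI_real : SpectralFlow.conjOp C I = I) (hI_sq : I * I = -1)
    -- an odd symmetric `F` in the retracted space and an odd symmetric unitary `U`
    (F : H →L[ℂ] H) (hF : F ∈ SpectralFlow.SFHat H)
    (hF_odd : SpectralFlow.IsOddSymmetric C I F)
    (U : H →L[ℂ] H) (hU : U ∈ unitary (H →L[ℂ] H))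
    (hU_odd : SpectralFlow.IsOddSymmetric C I U) :
    -- the spectral flow over the first half is well defined for every path in `Θ(F, U, I)`
    (∀ γ ∈ SpectralFlow.Theta C I F U, ∃! m : ℤ, SpectralFlow.HasSpectralFlow γ 0 (1 / 2) m) ∧
    -- modulo `2` it does not depend on the path
    (∀ γ ∈ SpectralFlow.Theta C I F U, ∀ γ' ∈ SpectralFlow.Theta C I F U,
      ((SpectralFlow.SF γ 0 (1 / 2) : ℤ) : ZMod 2) = (SpectralFlow.SF γ' 0 (1 / 2) : ℤ)) ∧
    (∀ γ ∈ SpectralFlow.Theta C I F U,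
      SpectralFlow.SF2 C I F U = ((SpectralFlow.SF γ 0 (1 / 2) : ℤ) : ZMod 2)) ∧
    -- paths exist exactly when `[F, U]` is compact, and then the linear path computes the flow
    ((SpectralFlow.Theta C I F U).Nonempty ↔ IsCompactOperator (F * U - U * F)) ∧
    (IsCompactOperator (F * U - U * F) →
      SpectralFlow.linPath F U ∈ SpectralFlow.Theta C I F U ∧
      SpectralFlow.SF2 C I F U =
        ((SpectralFlow.SF (SpectralFlow.linPath F U) 0 (1 / 2) : ℤ) : ZMod 2)) := by
  obtain ⟨hwd, hmod⟩ := SpectralFlow.SF_emod_two_eq hC hI_unitary hI_real hI_sq hF hU hU_odd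
  have hlin := SpectralFlow.linPath_mem_Theta hC hI_unitary hI_real hI_sq hF hF_odd hU hU_odd
  have hSF2 : ∀ γ ∈ SpectralFlow.Theta C I F U,
      SpectralFlow.SF2 C I F U = ((SpectralFlow.SF γ 0 (1 / 2) : ℤ) : ZMod 2) := by
    intro γ hγ
    have hne : (SpectralFlow.Theta C I F U).Nonempty := ⟨γ, hγ⟩
    rw [SpectralFlow.SF2, dif_pos hne]
    exact hmod _ hne.choose_spec γ hγ
  exact ⟨hwd, hmod, hSF2,
    ⟨fun ⟨γ, hγ⟩ => SpectralFlow.isCompactOperator_commutator_of_mem_Theta hC hI_unitary hF hF_odd hU hγ,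
      fun h => ⟨_, hlin h⟩⟩, fun h => ⟨hlin h, hSF2 _ (hlin h)⟩⟩
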